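/- In the $\mathsf{CONGEST}$ model, a network is a connected simple undirected unweighted graph $G=(V,E)$ with $n=|V|$ nodes, which carry distinct identifiers bounded by a fixed polynomial $n^{c}$. Each node initially knows $n$, its own identifier, those of its neighbours and its own input, and it has private independent fair random bits. In every synchronous round a node may send a (different) message of $O(\log n)$ bits to each of its neighbours; local computation is free. Let $D$ be the diameter of $G$ and, for nonempty $S,T\subseteq V$, let $D_{ST}=\max_{s\in S,\,t\in T}d(s,t)$ be the $ST$-diameter, which is called bi-chromatic if $S=V\setminus T$. **Theorem.** There is a randomized $\mathsf{CONGEST}$ algorithm which, on every such network $G$ and for every partition of $V$ into nonempty sets $S$ and $T=V\setminus S$ (each node knows which of the two it belongs to), terminates at all nodes within $\tilde O(\sqrt n+D)$ rounds, and with high probability makes all nodes output one common integer $D^*$ with $$\Big\lfloor \tfrac{3}{5}D_{ST}\Big\rfloor\;\le\; D^*\;\le\; D_{ST}.$$ In particular $D^*\le D_{ST}\le \tfrac53 D^*+\tfrac43$, so $D^*$ is a $5/3$-approximation of the bi-chromatic diameter up to a small additive error that is only due to rounding. Here the nodes do not know $D$. In detail: for every $c$ there are constants $B,e$ such that for every $k$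 there are a constant $C$ and an algorithm with messages of at most $B\lceil\log_2 n\rceil$ bits which always terminates within $C(\log n)^{e}(\sqrt n+D)$ rounds, and whose output is correct with probability at least $1-n^{-k}$. -/

import Mathlib

open MeasureTheory

/-- A randomized algorithm in the synchronous message-passing model with messages of at most `b`
bits per edge, direction and round (`CONGEST` when `b = O(log n)`).  It is the program run by every
node; local computation is unbounded.  `In` and `Out` are the types of the problem-specific local
inputs and outputs. -/
structure CongestAlgorithm (b : ℕ) (In Out : Type) where
  /-- the local states of a node -/
  State : Type
  /-- the number of private random bits that each node draws -/
  coins : ℕ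
  /-- the initial state, computed from the identifier of the node, the identifiers of its
  neighbours, its input and its private random bits -/
  init : ℕ → Finset ℕ → In → (Fin coins → Bool) → State
  /-- the message (`none` is silence) sent to the neighbour with a given identifier -/
  send : State → ℕ → Option (BitVec b)
  /-- the state after a round, from the state before it and the received messages, which are
  indexed by the identifiers of their senders -/
  step : State → (ℕ → Option (BitVec b)) → State
  /-- a node halts as soon as this is `some y`, and `y` is then its output -/
  output : State → Option Out

namespace CongestAlgorithm

variable {b : ℕ} {In Out : Type} {V : Type}

/-- The messages received by `v` in one round, when the states are `σ` and the network is the graph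
`G` with identifiers `ident`: from each neighbour that has not halted, the message which it sends to
`v`, and nothing from anybody else. -/
noncomputable def inbox (A : CongestAlgorithm b In Out) (G : SimpleGraph V) (ident : V → ℕ)
    (σ : V → A.State) (v : V) : ℕ → Option (BitVec b) :=
  open Classical in
  Function.extend ident
    (fun u => if G.Adj u v ∧ A.output (σ u) = none then A.send (σ u) (ident v) else none)
    (fun _ => none)

/-- One synchronous round.  A node that has halted keeps its state for ever. -/
noncomputable def round (A : CongestAlgorithm b In Out) (G : SimpleGraph V) (ident : V → ℕ)
    (σ : V → A.State) (v : V) : A.State :=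
  open Classical in
  if A.output (σ v) = none then A.step (σ v) (A.inbox G ident σ v) else σ v

/-- The initial states, for local inputs `x` and random bits `ω`. -/
noncomputable def start [Fintype V] (A : CongestAlgorithm b In Out) (G : SimpleGraph V)
    (ident : V → ℕ) (x : V → In) (ω : V → Fin A.coins → Bool) (v : V) : A.State :=
  open Classical in
  A.init (ident v) ((Finset.univ.filter (fun u => G.Adj v u)).image ident) (x v) (ω v)

/-- The output of `v` if it has halted within the first `t` rounds, and `none` otherwise. -/
noncomputable def outputAt [Fintype V] (A : CongestAlgorithm b In Out) (G : SimpleGraph V)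
    (ident : V → ℕ) (x : V → In) (ω : V → Fin A.coins → Bool) (t : ℕ) (v : V) : Option Out :=
  A.output ((A.round G ident)^[t] (A.start G ident x ω) v)

end CongestAlgorithm

/-- The law of the random bits: `m` bits for each node, all independent and fair. -/
noncomputable def coinMeasure (V : Type) [Fintype V] [DecidableEq V] (m : ℕ) :
    Measure (V → Fin m → Bool) :=
  (PMF.uniformOfFintype (V → Fin m → Bool)).toMeasure

/-- The `ST`-diameter: the largest distance between a vertex of `S` and a vertex of `T` (for a
connected graph and nonempty `S` and `T`). -/
noncomputable def stDiam {V : Type} (G : SimpleGraph V) (S T : Finset V) : ℕ :=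
  S.sup fun s => T.sup fun t => G.dist s t

/-! Each node is a sample with probability about $1/\sqrt n$. Let $w\in S$ be farthest from the
projections of the samples to $S$, and let $R$ consist of projections to $T$ of vertices $v$ whose
key $d(w,v)+d(v,S)$ is among the smallest. The output is the largest distance from sample
projections and $w$ to $T$, and from $R$ to $S$. These are distances between $S$ and $T$, so
$D_{ST}$ is never exceeded.

The lower bound is `three_mul_dist_div_five_le`. Let $d(s_0,t_0)=D_{ST}$, $L=\lfloor
3D_{ST}/5\rfloor$, $M=D_{ST}-L$, and suppose that all distances found are below $L$. The sample
projections are then farther than $M$ from $s_0$, hence also from $w$, so every sample has key above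
$M$. With high probability only $\tilde O(\sqrt n)$ vertices have key at most $M$; hence $R$
contains all their projections to $T$, and these are farther than $M$ from $t_0$. A shortest path
from $w$ to $t_0$ has fewer than $L$ steps. It must be in $S$ after $\lfloor M/2\rfloor$ steps, and
cannot cross into $T$ up to step $M$, as the crossing would put a projection too close to $t_0$. If
it is still in $S$ at step $M$, then $t_0$ is so near that the projection of this vertex is also too
close to $t_0$.

The round bound rests on pipelining: by `gossip_progress` and `bfs_progress`, $K$ tokens or sources
cost about $D+K$ rounds. Since $D$ is unknown, powers of two are guessed and tested by comparing
local leaders (`exists_first_guess`). `le_coinMeasure_goodSample` bounds the failure probability,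
and `main_correct` identifies the phase results with distances. -/

/-! ### The phase protocol

Tokens are natural numbers.  In a phase with parameter `N` every node repeatedly sends the smallest
token that it has not sent yet and that is minimal among its known tokens with the same residue
modulo `N`, and the receiver adds `N` to it.  For `N = 0` this is gossip, and for large `N` it is
pipelined breadth-first search, where a token `N * d + a` says that the source `a` is at
distance at most `d`. -/

/-- The token to be sent next, when `K` are the known tokens and `S` the tokens already sent. -/
noncomputable def pendingToken (N : ℕ) (K S : Finset ℕ) : Option ℕ :=
  open Classical in
  let P := K.filter fun τ => τ ∉ S ∧ ∀ τ' ∈ K, τ' % N = τ % N → τ ≤ τ'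
  if h : P.Nonempty then some (P.min' h) else none

/-- The known and the sent tokens of a node during a phase. -/
structure TokenState where
  known : Finset ℕ
  sent : Finset ℕ

/-- One round of a phase with parameter `N` and messages of `b` bits. -/
noncomputable def phaseStep {V : Type} [Fintype V] (b N : ℕ) (G : SimpleGraph V)
    (σ : V → TokenState) (v : V) : TokenState :=
  open Classical in
  { known := (σ v).known ∪ (Finset.univ.filter (G.Adj v)).biUnion fun u =>
      ((pendingToken N (σ u).known (σ u).sent).map fun τ => τ % 2 ^ b + N).toFinset
    sent := (σ v).sent ∪ (pendingToken N (σ v).known (σ v).sent).toFinset }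

/-- The token states after `r` rounds of a phase that starts with the token sets `init`. -/
noncomputable def phaseRun {V : Type} [Fintype V] (b N : ℕ) (G : SimpleGraph V)
    (init : V → Finset ℕ) (r : ℕ) : V → TokenState :=
  (phaseStep b N G)^[r] fun v => ⟨init v, ∅⟩

/-! ### Execution of phase programs by message passing -/

/-- What a node does next: halt with an output, or run a phase of `T + 1` rounds with parameter `N`,
starting with a given set of tokens. -/
inductive PhaseInstr (Out : Type) where
  | halt (y : Out)
  | phase (N T : ℕ) (tokens : Finset ℕ)

/-- A node program that consists of phases. -/
structure PhaseProgram (In Out : Type) where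
  Mem : Type
  coins : ℕ
  start : ℕ → In → (Fin coins → Bool) → Mem
  instr : Mem → PhaseInstr Out
  update : Mem → Finset ℕ → Mem

namespace PhaseProgram

variable {In Out V : Type}

/-- The state of a node that runs a phase program. -/
structure NodeState (P : PhaseProgram In Out) where
  nbrs : Finset ℕ
  mem : P.Mem
  tok : TokenState
  clock : ℕ

/-- The tokens with which the next phase starts. -/
def initTokens {Out : Type} : PhaseInstr Out → Finset ℕ
  | .halt _ => ∅
  | .phase _ _ F => F

/-- The state of a node at the beginning of a phase. -/
def fresh (P : PhaseProgram In Out) (nbrs : Finset ℕ) (m : P.Mem) : P.NodeState :=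
  ⟨nbrs, m, ⟨initTokens (P.instr m), ∅⟩, 0⟩

/-- The token states after one round, in terms of the messages received. -/
noncomputable def receive {b : ℕ} (N : ℕ) (nbrs : Finset ℕ) (t : TokenState)
    (inbox : ℕ → Option (BitVec b)) : TokenState :=
  { known := t.known ∪ nbrs.biUnion fun i => ((inbox i).map fun x => x.toNat + N).toFinset
    sent := t.sent ∪ (pendingToken N t.known t.sent).toFinset }

/-- The message-passing algorithm that executes a phase program. -/
noncomputable def toCongest (P : PhaseProgram In Out) (b : ℕ) : CongestAlgorithm b In Out where
  State := P.NodeState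
  coins := P.coins
  init i nbrs x ω := P.fresh nbrs (P.start i x ω)
  send s _ := match P.instr s.mem with
    | .halt _ => none
    | .phase N _ _ => (pendingToken N s.tok.known s.tok.sent).map (BitVec.ofNat b)
  step s inbox := match P.instr s.mem with
    | .halt _ => s
    | .phase N T _ =>
      let t := receive N s.nbrs s.tok inbox
      if s.clock < T then { s with tok := t, clock := s.clock + 1 }
      else P.fresh s.nbrs (P.update s.mem t.known)
  output s := match P.instr s.mem with
    | .halt y => some y
    | .phase _ _ _ => none

variable [Fintype V] (P : PhaseProgram In Out) (b : ℕ) (G : SimpleGraph V) (ident : V → ℕ)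

/-- The identifiers of the neighbours of `v`. -/
noncomputable def nbrIdents (v : V) : Finset ℕ :=
  open Classical in (Finset.univ.filter (fun u => G.Adj v u)).image ident

/-- All nodes are in the same phase at the same clock value, so no neighbour has halted. Injectivity
of `ident` ensures that each inbox entry comes from the intended neighbour. -/
theorem round_phase (hid : Function.Injective ident) {m : V → P.Mem} {N T : ℕ}
    {F : V → Finset ℕ} (hm : ∀ v, P.instr (m v) = .phase N T (F v)) (t : V → TokenState) (k : ℕ) :
    (P.toCongest b).round G ident (fun v => ⟨nbrIdents G ident v, m v, t v, k⟩) =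
      fun v => if k < T then ⟨nbrIdents G ident v, m v, phaseStep b N G t v, k + 1⟩
        else P.fresh (nbrIdents G ident v) (P.update (m v) (phaseStep b N G t v).known) := by
  classical
  funext v
  have hrec : receive N (nbrIdents G ident v) (t v)
      ((P.toCongest b).inbox G ident (fun v => ⟨nbrIdents G ident v, m v, t v, k⟩) v) =
      phaseStep b N G t v := by
    unfold receive phaseStep
    congr 2
    unfold nbrIdents
    rw [Finset.image_biUnion]
    have hset : ∀ (f g : V → Finset ℕ), (∀ u, G.Adj v u → f u = g u) →
        (Finset.univ.filter (G.Adj v)).biUnion f = (Finset.univ.filter (G.Adj v)).biUnion g :=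
      fun f g h => Finset.biUnion_congr rfl fun u hu => h u (by simpa using hu)
    apply hset
    intro u hu
    simp only [CongestAlgorithm.inbox]
    rw [hid.extend_apply]
    simp [toCongest, hm, hu.symm, Option.map_map, Function.comp_def]
  have ho : (P.toCongest b).output ⟨nbrIdents G ident v, m v, t v, k⟩ = none := by
    simp [toCongest, hm]
  refine (if_pos ho).trans ?_
  simp only [toCongest, hm] at hrec ⊢
  rw [hrec]

/-- At time `t`, with random bits `ω`, all nodes are at the beginning of a phase, and the node `v`
has the memory `m v`. -/
def ReachesAt (x : V → In) (ω : V → Fin P.coins → Bool) (t : ℕ) (m : V → P.Mem) : Prop :=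
  ((P.toCongest b).round G ident)^[t] ((P.toCongest b).start G ident x ω) =
    fun v => P.fresh (nbrIdents G ident v) (m v)

variable {P b G ident}

theorem reachesAt_zero (x : V → In) (ω : V → Fin P.coins → Bool) :
    P.ReachesAt b G ident x ω 0 fun v => P.start (ident v) (x v) (ω v) := rfl

theorem ReachesAt.of_time_eq {x : V → In} {ω : V → Fin P.coins → Bool} {t t' : ℕ}
    {m : V → P.Mem} (h : P.ReachesAt b G ident x ω t m) (ht : t = t') :
    P.ReachesAt b G ident x ω t' m := ht ▸ h

/-- The memory is updated in the round that starts with clock value `T`, and this round still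
delivers messages; hence `T + 1` rounds. -/
theorem ReachesAt.phase (hid : Function.Injective ident) {x : V → In}
    {ω : V → Fin P.coins → Bool} {t : ℕ} {m : V → P.Mem} (h : P.ReachesAt b G ident x ω t m)
    {N T : ℕ} {F : V → Finset ℕ} (hm : ∀ v, P.instr (m v) = .phase N T (F v)) :
    P.ReachesAt b G ident x ω (t + (T + 1))
      fun v => P.update (m v) (phaseRun b N G F (T + 1) v).known := by
  have key : ∀ r ≤ T, ((P.toCongest b).round G ident)^[t + r]
      ((P.toCongest b).start G ident x ω) =
      fun v => (⟨nbrIdents G ident v, m v, phaseRun b N G F r v, r⟩ : P.NodeState) := by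
    intro r
    induction r with
    | zero =>
      intro _
      rw [Nat.add_zero, h]
      funext v
      simp [fresh, phaseRun, initTokens, hm]
    | succ r ih =>
      intro hr
      rw [← Nat.add_assoc, Function.iterate_succ_apply', ih (by omega)]
      refine (round_phase P b G ident hid hm _ r).trans ?_
      funext v
      rw [if_pos (by omega), phaseRun, phaseRun, Function.iterate_succ_apply']
  unfold ReachesAt
  rw [← Nat.add_assoc, Function.iterate_succ_apply', key T le_rfl]
  refine (round_phase P b G ident hid hm _ T).trans ?_
  funext v
  rw [if_neg (lt_irrefl T), phaseRun, phaseRun, Function.iterate_succ_apply']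

theorem ReachesAt.outputAt_eq {x : V → In} {ω : V → Fin P.coins → Bool} {t : ℕ} {m : V → P.Mem}
    (h : P.ReachesAt b G ident x ω t m) {v : V} {y : Out} (hm : P.instr (m v) = .halt y) :
    (P.toCongest b).outputAt G ident x ω t v = some y := by
  unfold CongestAlgorithm.outputAt
  rw [h]
  simp [toCongest, fresh, hm]

end PhaseProgram

section Pending

variable {N : ℕ} {K S : Finset ℕ} {τ : ℕ}

theorem pendingToken_eq_some_iff : pendingToken N K S = some τ ↔
    (τ ∈ K ∧ τ ∉ S ∧ ∀ τ' ∈ K, τ' % N = τ % N → τ ≤ τ') ∧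
      ∀ ρ ∈ K, ρ ∉ S → (∀ τ' ∈ K, τ' % N = ρ % N → ρ ≤ τ') → τ ≤ ρ := by
  classical
  unfold pendingToken
  simp only
  split_ifs with h
  · rw [Option.some_inj]
    constructor
    · rintro rfl
      refine ⟨by simpa using Finset.min'_mem _ h, fun ρ h1 h2 h3 => Finset.min'_le _ _ ?_⟩
      simpa using ⟨h1, h2, h3⟩
    · rintro ⟨h1, h2⟩
      apply le_antisymm
      · exact Finset.min'_le _ _ (by simpa using h1)
      · refine Finset.le_min' _ _ _ fun ρ hρ => ?_
        simp only [Finset.mem_filter] at hρ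
        exact h2 ρ hρ.1 hρ.2.1 hρ.2.2
  · simp only [false_iff]
    rintro ⟨h1, -⟩
    exact h ⟨τ, by simpa using h1⟩

/-- If some current token is unsent, then a token that is at most as large is pending. -/
theorem exists_pendingToken_le (h1 : τ ∈ K) (h2 : τ ∉ S)
    (h3 : ∀ τ' ∈ K, τ' % N = τ % N → τ ≤ τ') :
    ∃ ρ ≤ τ, pendingToken N K S = some ρ := by
  classical
  have hne : (K.filter fun τ => τ ∉ S ∧ ∀ τ' ∈ K, τ' % N = τ % N → τ ≤ τ').Nonempty :=
    ⟨τ, by simpa using ⟨h1, h2, h3⟩⟩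
  refine ⟨Finset.min' _ hne, Finset.min'_le _ _ (by simpa using ⟨h1, h2, h3⟩), ?_⟩
  unfold pendingToken
  simp only
  rw [dif_pos hne]

end Pending

/-! ### Vertices on shortest paths -/

namespace SimpleGraph

variable {V : Type} {G : SimpleGraph V}

theorem Connected.exists_dist_eq_of_le (hG : G.Connected) {u v : V} {i : ℕ}
    (hi : i ≤ G.dist u v) : ∃ x, G.dist u x = i ∧ G.dist x v = G.dist u v - i := by
  obtain ⟨p, hp⟩ := hG.exists_walk_length_eq_dist u v
  have h1 : G.dist u (p.getVert i) ≤ i :=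
    (dist_le (p.take i)).trans (by rw [Walk.take_length]; exact min_le_left _ _)
  have h2 : G.dist (p.getVert i) v ≤ G.dist u v - i :=
    (dist_le (p.drop i)).trans (by rw [Walk.drop_length, hp])
  have h3 := hG.dist_triangle (u := u) (v := p.getVert i) (w := v)
  exact ⟨p.getVert i, by omega, by omega⟩

theorem Connected.exists_adj_dist_eq (hG : G.Connected) {u v : V} {h : ℕ}
    (hd : G.dist u v = h + 1) : ∃ y, G.Adj v y ∧ G.dist u y = h := by
  obtain ⟨y, h1, h2⟩ := hG.exists_dist_eq_of_le (u := u) (v := v) (i := h) (by omega)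
  exact ⟨y, (dist_eq_one_iff_adj.1 (by omega)).symm, h1⟩

theorem Connected.dist_le_succ_of_adj (hG : G.Connected) {u v y : V} (h : G.Adj v y) :
    G.dist u v ≤ G.dist u y + 1 := by
  have := hG.dist_triangle (u := u) (v := y) (w := v)
  rw [dist_eq_one_iff_adj.2 h.symm] at this
  exact this

end SimpleGraph

/-! ### Monotonicity and delivery of tokens in a phase -/

section Phase

variable {V : Type} [Fintype V] {b N : ℕ} {G : SimpleGraph V} {init : V → Finset ℕ}

theorem phaseRun_succ (r : ℕ) :
    phaseRun b N G init (r + 1) = phaseStep b N G (phaseRun b N G init r) :=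
  Function.iterate_succ_apply' _ _ _

theorem mem_phaseRun_succ_known {r : ℕ} {v : V} {τ : ℕ} :
    τ ∈ (phaseRun b N G init (r + 1) v).known ↔ τ ∈ (phaseRun b N G init r v).known ∨
      ∃ u, G.Adj v u ∧ ∃ ρ, pendingToken N (phaseRun b N G init r u).known
        (phaseRun b N G init r u).sent = some ρ ∧ τ = ρ % 2 ^ b + N := by
  classical
  rw [phaseRun_succ]
  simp [phaseStep, eq_comm]

theorem mem_phaseRun_succ_sent {r : ℕ} {v : V} {τ : ℕ} :
    τ ∈ (phaseRun b N G init (r + 1) v).sent ↔ τ ∈ (phaseRun b N G init r v).sent ∨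
      pendingToken N (phaseRun b N G init r v).known
        (phaseRun b N G init r v).sent = some τ := by
  classical
  rw [phaseRun_succ]
  simp [phaseStep]

theorem phaseRun_known_mono {r r' : ℕ} (h : r ≤ r') (v : V) :
    (phaseRun b N G init r v).known ⊆ (phaseRun b N G init r' v).known := by
  induction h with
  | refl => exact Finset.Subset.refl _
  | step _ ih => exact fun τ hτ => mem_phaseRun_succ_known.2 (Or.inl (ih hτ))

theorem phaseRun_sent_mono {r r' : ℕ} (h : r ≤ r') (v : V) :
    (phaseRun b N G init r v).sent ⊆ (phaseRun b N G init r' v).sent := by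
  induction h with
  | refl => exact Finset.Subset.refl _
  | step _ ih => exact fun τ hτ => mem_phaseRun_succ_sent.2 (Or.inl (ih hτ))

theorem phaseRun_sent_subset_known (r : ℕ) (v : V) :
    (phaseRun b N G init r v).sent ⊆ (phaseRun b N G init r v).known := by
  induction r with
  | zero => simp [phaseRun]
  | succ r ih =>
    intro τ hτ
    refine phaseRun_known_mono r.le_succ v ?_
    rcases mem_phaseRun_succ_sent.1 hτ with h | h
    · exact ih h
    · exact (pendingToken_eq_some_iff.1 h).1.1

/-- What a node has sent has been received by its neighbours. -/
theorem mem_known_of_mem_sent {r : ℕ} {u v : V} (huv : G.Adj v u) {τ : ℕ}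
    (h : τ ∈ (phaseRun b N G init r u).sent) :
    τ % 2 ^ b + N ∈ (phaseRun b N G init r v).known := by
  induction r with
  | zero => simp [phaseRun] at h
  | succ r ih =>
    rw [mem_phaseRun_succ_known]
    rcases mem_phaseRun_succ_sent.1 h with h | h
    · exact Or.inl (ih h)
    · exact Or.inr ⟨u, huv, τ, h, rfl⟩

/-! ### Gossip -/

/-- In gossip, everything known has come from a node that is not too far away. -/
theorem gossip_sound (hG : G.Connected) (hb : ∀ v, ∀ τ ∈ init v, τ < 2 ^ b) {r : ℕ} {v : V}
    {τ : ℕ} (h : τ ∈ (phaseRun b 0 G init r v).known) : ∃ u, G.dist u v ≤ r ∧ τ ∈ init u := by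
  induction r generalizing v τ with
  | zero => exact ⟨v, by simp, h⟩
  | succ r ih =>
    rcases mem_phaseRun_succ_known.1 h with h | ⟨u, huv, ρ, hρ, rfl⟩
    · obtain ⟨u, h1, h2⟩ := ih h
      exact ⟨u, by omega, h2⟩
    · obtain ⟨w, h1, h2⟩ := ih (pendingToken_eq_some_iff.1 hρ).1.1
      have := hG.dist_le_succ_of_adj (u := w) huv
      refine ⟨w, by omega, ?_⟩
      rwa [Nat.mod_eq_of_lt (hb _ _ h2), Nat.add_zero]

/-- A node that knows `τ` or more than `j` smaller tokens sends one of these in the next round. -/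
theorem gossip_progress_aux {r j τ : ℕ} {u : V}
    (hk : τ ∈ (phaseRun b 0 G init r u).known ∨
      j + 1 ≤ ((phaseRun b 0 G init r u).known.filter (· < τ)).card)
    (hs : j ≤ ((phaseRun b 0 G init r u).sent.filter (· < τ)).card) :
    τ ∈ (phaseRun b 0 G init (r + 1) u).sent ∨
      j + 1 ≤ ((phaseRun b 0 G init (r + 1) u).sent.filter (· < τ)).card := by
  have hmono := phaseRun_sent_mono (b := b) (N := 0) (G := G) (init := init) r.le_succ u
  by_cases hτs : τ ∈ (phaseRun b 0 G init r u).sent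
  · exact Or.inl (hmono hτs)
  by_cases hj : j + 1 ≤ ((phaseRun b 0 G init r u).sent.filter (· < τ)).card
  · exact Or.inr (hj.trans (Finset.card_le_card (Finset.filter_subset_filter _ hmono)))
  have hex : ∃ ρ ≤ τ, ρ ∈ (phaseRun b 0 G init r u).known ∧
      ρ ∉ (phaseRun b 0 G init r u).sent := by
    rcases hk with hk | hk
    · exact ⟨τ, le_rfl, hk, hτs⟩
    · obtain ⟨ρ, h1, h2⟩ := Finset.exists_mem_notMem_of_card_lt_card
        (lt_of_lt_of_le (not_le.1 hj) hk)
      simp only [Finset.mem_filter, not_and] at h1 h2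
      exact ⟨ρ, h1.2.le, h1.1, fun h => h2 h h1.2⟩
  obtain ⟨ρ, hρτ, hρk, hρs⟩ := hex
  obtain ⟨π, hπρ, hπ⟩ := exists_pendingToken_le (N := 0) hρk hρs
    (fun τ' _ h => by simp only [Nat.mod_zero] at h; exact h.ge)
  have hπs : π ∈ (phaseRun b 0 G init (r + 1) u).sent :=
    mem_phaseRun_succ_sent.2 (Or.inr hπ)
  rcases (hπρ.trans hρτ).eq_or_lt with rfl | hlt
  · exact Or.inl hπs
  · right
    refine Nat.succ_le_of_lt (lt_of_le_of_lt hs (Finset.card_lt_card ?_))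
    refine (Finset.ssubset_iff_of_subset (Finset.filter_subset_filter _ hmono)).2
      ⟨π, Finset.mem_filter.2 ⟨hπs, hlt⟩, fun h => ?_⟩
    exact (pendingToken_eq_some_iff.1 hπ).1.2.1 (Finset.mem_filter.1 h).1

/-- Pipelining: only smaller tokens can delay `τ`, and each of them costs at most one round in
total, not one per hop. Counting smaller known tokens makes the claim inductive in the distance. -/
theorem gossip_progress (hG : G.Connected) (hb : ∀ v, ∀ τ ∈ init v, τ < 2 ^ b) {u₀ : V} {τ : ℕ}
    (hτ : τ ∈ init u₀) (h : ℕ) : ∀ (j : ℕ) (v : V), G.dist u₀ v ≤ h →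
      τ ∈ (phaseRun b 0 G init (h + j) v).known ∨
        j + 1 ≤ ((phaseRun b 0 G init (h + j) v).known.filter (· < τ)).card := by
  induction h with
  | zero =>
    intro j v hv
    have : u₀ = v := hG.dist_eq_zero_iff.1 (by omega)
    subst this
    exact Or.inl (phaseRun_known_mono (Nat.zero_le _) u₀ hτ)
  | succ h ih =>
    intro j v hv
    rcases Nat.lt_or_ge (G.dist u₀ v) (h + 1) with hlt | hge
    · rcases ih (j + 1) v (by omega) with h1 | h1
      · left; rwa [Nat.add_assoc, Nat.add_comm 1 j]
      · right; rw [Nat.add_assoc, Nat.add_comm 1 j]; omega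
    obtain ⟨u, hvu, hu⟩ := hG.exists_adj_dist_eq (u := u₀) (v := v) (h := h) (by omega)
    -- The neighbour one hop closer has its `j`-th relevant token one round before it must send it,
    -- so its sent set keeps pace.
    have key : ∀ j, τ ∈ (phaseRun b 0 G init (h + j + 1) u).sent ∨
        j + 1 ≤ ((phaseRun b 0 G init (h + j + 1) u).sent.filter (· < τ)).card := by
      intro j
      induction j with
      | zero => exact gossip_progress_aux (ih 0 u hu.le) (Nat.zero_le _)
      | succ j ihj =>
        rcases ihj with hs | hs
        · exact Or.inl (phaseRun_sent_mono (Nat.le_succ _) u hs)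
        · exact gossip_progress_aux (ih (j + 1) u hu.le) hs
    have hsub : (phaseRun b 0 G init (h + 1 + j) u).sent ⊆
        (phaseRun b 0 G init (h + 1 + j) v).known := by
      intro ρ hρ
      obtain ⟨w, -, hw⟩ := gossip_sound hG hb (phaseRun_sent_subset_known _ _ hρ)
      have := mem_known_of_mem_sent hvu hρ
      rwa [Nat.mod_eq_of_lt (hb _ _ hw), Nat.add_zero] at this
    have := key j
    rw [Nat.add_right_comm h j 1] at this
    rcases this with hs | hs
    · exact Or.inl (hsub hs)
    · exact Or.inr (hs.trans (Finset.card_le_card (Finset.filter_subset_filter _ hsub)))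

end Phase

/-! ### What gossip computes: smallest tokens, full sets, minima -/

/-- The `K` smallest elements of `F`. -/
def smallestElts (K : ℕ) (F : Finset ℕ) : Finset ℕ :=
  F.filter fun τ => (F.filter (· < τ)).card < K

theorem card_smallestElts_le (K : ℕ) (F : Finset ℕ) : (smallestElts K F).card ≤ K := by
  have hmaps : ∀ τ ∈ smallestElts K F, (F.filter (· < τ)).card ∈ Finset.range K := by
    intro τ hτ
    simpa using (Finset.mem_filter.1 hτ).2
  refine (Finset.card_le_card_of_injOn _ hmaps ?_).trans (Finset.card_range K).le
  have hlt : ∀ τ ∈ F, ∀ ρ, τ < ρ → (F.filter (· < τ)).card < (F.filter (· < ρ)).card := by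
    intro τ hτ ρ h
    refine Finset.card_lt_card ((Finset.ssubset_iff_of_subset ?_).2 ⟨τ, by simp [hτ, h], by simp⟩)
    intro x hx
    simp only [Finset.mem_filter] at hx ⊢
    exact ⟨hx.1, hx.2.trans h⟩
  intro τ hτ ρ hρ h
  have hτF := (Finset.mem_filter.1 hτ).1
  have hρF := (Finset.mem_filter.1 hρ).1
  rcases lt_trichotomy τ ρ with h' | h' | h'
  · exact absurd h (hlt τ hτF ρ h').ne
  · exact h'
  · exact absurd h (hlt ρ hρF τ h').ne'

section Gossip

variable {V : Type} [Fintype V] {b : ℕ} {G : SimpleGraph V} {init : V → Finset ℕ}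

theorem gossip_known_subset (hG : G.Connected) (hb : ∀ v, ∀ τ ∈ init v, τ < 2 ^ b) (r : ℕ)
    (v : V) : (phaseRun b 0 G init r v).known ⊆ Finset.univ.biUnion init := by
  intro τ hτ
  obtain ⟨u, -, hu⟩ := gossip_sound hG hb hτ
  exact Finset.mem_biUnion.2 ⟨u, Finset.mem_univ u, hu⟩

theorem gossip_mem_known (hG : G.Connected) (hb : ∀ v, ∀ τ ∈ init v, τ < 2 ^ b) {D r j : ℕ}
    (hD : ∀ u v, G.dist u v ≤ D) {τ : ℕ} (hτ : τ ∈ Finset.univ.biUnion init)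
    (hj : ((Finset.univ.biUnion init).filter (· < τ)).card ≤ j) (hr : D + j ≤ r) (v : V) :
    τ ∈ (phaseRun b 0 G init r v).known := by
  obtain ⟨u, -, hu⟩ := Finset.mem_biUnion.1 hτ
  rcases gossip_progress hG hb hu D j v (hD u v) with h | h
  · exact phaseRun_known_mono hr v h
  · have := Finset.card_le_card (Finset.filter_subset_filter (· < τ)
      (gossip_known_subset hG hb (D + j) v))
    omega

/-- The total number of tokens is not bounded here: larger tokens never delay smaller ones, so all
nodes agree on the first `K`. -/
theorem gossip_smallestElts (hG : G.Connected) (hb : ∀ v, ∀ τ ∈ init v, τ < 2 ^ b) {D r K : ℕ}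
    (hD : ∀ u v, G.dist u v ≤ D) (hr : D + K ≤ r) (v : V) :
    smallestElts K (phaseRun b 0 G init r v).known =
      smallestElts K (Finset.univ.biUnion init) := by
  have hsub := gossip_known_subset hG hb r v
  have hknown : ∀ τ ∈ Finset.univ.biUnion init,
      ((Finset.univ.biUnion init).filter (· < τ)).card < K →
        τ ∈ (phaseRun b 0 G init r v).known :=
    fun τ hτ h => gossip_mem_known hG hb hD hτ h.le hr v
  generalize (phaseRun b 0 G init r v).known = A at *
  generalize Finset.univ.biUnion init = U at *
  ext τ
  simp only [smallestElts, Finset.mem_filter]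
  constructor
  · rintro ⟨hτA, hτ⟩
    refine ⟨hsub hτA, lt_of_le_of_lt (Finset.card_le_card ?_) hτ⟩
    by_contra hcon
    -- Take the smallest missing token below `τ`. All tokens below it are present, so its global
    -- rank is less than `K` and it must have arrived.
    obtain ⟨ρ, hρ, hmin⟩ := Finset.exists_min_image
      ((U.filter (· < τ)) \ (A.filter (· < τ))) id (Finset.sdiff_nonempty.2 hcon)
    simp only [Finset.mem_sdiff, Finset.mem_filter, not_and, id_eq] at hρ hmin
    refine hρ.2 (hknown ρ hρ.1.1 (lt_of_le_of_lt (Finset.card_le_card ?_) hτ)) hρ.1.2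
    intro π hπ
    simp only [Finset.mem_filter] at hπ ⊢
    have hπτ := hπ.2.trans hρ.1.2
    refine ⟨?_, hπτ⟩
    by_contra hπA
    exact absurd hπ.2 (not_lt.2 (hmin π ⟨⟨hπ.1, hπτ⟩, fun h => absurd h hπA⟩))
  · rintro ⟨hτU, hτ⟩
    exact ⟨hknown τ hτU hτ,
      lt_of_le_of_lt (Finset.card_le_card (Finset.filter_subset_filter _ hsub)) hτ⟩

theorem gossip_all (hG : G.Connected) (hb : ∀ v, ∀ τ ∈ init v, τ < 2 ^ b) {D r K : ℕ}
    (hD : ∀ u v, G.dist u v ≤ D) (hK : (Finset.univ.biUnion init).card ≤ K) (hr : D + K ≤ r)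
    (v : V) : (phaseRun b 0 G init r v).known = Finset.univ.biUnion init :=
  (gossip_known_subset hG hb r v).antisymm fun _ hτ => gossip_mem_known hG hb hD hτ
    ((Finset.card_le_card (Finset.filter_subset _ _)).trans hK) hr v

/-- Nothing precedes the minimum, so it travels without delay and `D` rounds suffice. -/
theorem gossip_sInf (hG : G.Connected) (hb : ∀ v, ∀ τ ∈ init v, τ < 2 ^ b) {D r : ℕ}
    (hD : ∀ u v, G.dist u v ≤ D) (hne : (Finset.univ.biUnion init).Nonempty) (hr : D ≤ r)
    (v : V) : sInf ((phaseRun b 0 G init r v).known : Set ℕ) =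
      sInf (Finset.univ.biUnion init : Finset ℕ) := by
  have hsub := gossip_known_subset hG hb r v
  have hmem := Nat.sInf_mem (s := (Finset.univ.biUnion init : Finset ℕ)) hne
  have hknown := gossip_mem_known hG hb hD hmem (j := 0) (by
    rw [Nat.le_zero, Finset.card_eq_zero, Finset.filter_eq_empty_iff]
    exact fun x hx => not_lt.2 (Nat.sInf_le hx)) hr v
  refine le_antisymm (Nat.sInf_le hknown) (Nat.sInf_le ?_)
  exact hsub (Nat.sInf_mem (s := ((phaseRun b 0 G init r v).known : Set ℕ)) ⟨_, hknown⟩)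

end Gossip

/-! ### Pipelined breadth-first search -/

section BFS

theorem mod_of_token {V : Type} {ident : V → ℕ} {N : ℕ} (hid : ∀ v, ident v < N) (d : ℕ) (u : V) :
    (N * d + ident u) % N = ident u := by
  rw [Nat.mul_add_mod, Nat.mod_eq_of_lt (hid u)]

theorem div_of_token {V : Type} {ident : V → ℕ} {N : ℕ} (hid : ∀ v, ident v < N) (d : ℕ) (u : V) :
    (N * d + ident u) / N = d := by
  have := hid u
  rw [Nat.mul_add_div (by omega), Nat.div_eq_of_lt this, Nat.add_zero]

variable {V : Type} {b N : ℕ} {G : SimpleGraph V} {ident : V → ℕ} {R : Finset V}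

/-- The final token of the source `u` at `v`. -/
noncomputable def distToken (N : ℕ) (G : SimpleGraph V) (ident : V → ℕ) (v u : V) : ℕ :=
  N * G.dist u v + ident u

theorem dist_le_of_distToken_le (hid : ∀ v, ident v < N) {u u' v v' : V}
    (h : distToken N G ident v u ≤ distToken N G ident v' u') : G.dist u v ≤ G.dist u' v' := by
  have := Nat.div_le_div_right (c := N) h
  rwa [distToken, distToken, div_of_token hid, div_of_token hid] at this

variable [Fintype V] [DecidableEq V]

/-- The initial tokens of a breadth-first search from the sources `R`. -/
def sourceTokens (ident : V → ℕ) (R : Finset V) (v : V) : Finset ℕ :=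
  if v ∈ R then {ident v} else ∅

/-- A token known after `r` rounds has a distance part of at most `r`, so `N * (r + 1) ≤ 2 ^ b`
keeps the reduction modulo `2 ^ b` from altering it. -/
theorem bfs_sound (hG : G.Connected) (hid : ∀ v, ident v < N) {r : ℕ} (hb : N * (r + 1) ≤ 2 ^ b)
    {v : V} {τ : ℕ} (h : τ ∈ (phaseRun b N G (sourceTokens ident R) r v).known) :
    ∃ u ∈ R, ∃ d ≤ r, G.dist u v ≤ d ∧ τ = N * d + ident u := by
  induction r generalizing v τ with
  | zero =>
    simp only [phaseRun, Function.iterate_zero, id_eq, sourceTokens] at h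
    split_ifs at h with hv
    · exact ⟨v, hv, 0, le_rfl, by simp, by simpa using h⟩
    · simp at h
  | succ r ih =>
    have hb' : N * (r + 1) ≤ 2 ^ b := le_trans (Nat.mul_le_mul_left _ (by omega)) hb
    rcases mem_phaseRun_succ_known.1 h with h | ⟨y, hvy, ρ, hρ, rfl⟩
    · obtain ⟨u, hu, d, hd, h1, h2⟩ := ih hb' h
      exact ⟨u, hu, d, by omega, h1, h2⟩
    · obtain ⟨u, hu, d, hd, h1, rfl⟩ := ih hb' (pendingToken_eq_some_iff.1 hρ).1.1
      have := hG.dist_le_succ_of_adj (u := u) hvy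
      refine ⟨u, hu, d + 1, by omega, by omega, ?_⟩
      have h3 : N * d ≤ N * r := Nat.mul_le_mul_left _ hd
      have h4 := hid u
      rw [Nat.mod_eq_of_lt (by rw [Nat.mul_succ] at hb'; omega)]
      ring

/-- The final token of `u` at `v` is delayed beyond the distance only by the sources ranked before
`u` at `v`. Outdated tokens do no harm, as the more highly ranked sources have already sent their
final ones. -/
theorem bfs_progress (hG : G.Connected) (hinj : Function.Injective ident)
    (hid : ∀ v, ident v < N) (r : ℕ) (hb : N * (r + 1) ≤ 2 ^ b) :
    ∀ v, ∀ u ∈ R, G.dist u v +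
        (R.filter fun u' => distToken N G ident v u' < distToken N G ident v u).card ≤ r →
      distToken N G ident v u ∈ (phaseRun b N G (sourceTokens ident R) r v).known ∧
        distToken N G ident v u ∈ (phaseRun b N G (sourceTokens ident R) (r + 1) v).sent := by
  induction r using Nat.strong_induction_on with
  | _ r IH =>
  have hb' : ∀ s ≤ r, N * (s + 1) ≤ 2 ^ b :=
    fun s hs => le_trans (Nat.mul_le_mul_left _ (by omega)) hb
  intro v u hu hr
  have hknown : distToken N G ident v u ∈ (phaseRun b N G (sourceTokens ident R) r v).known := by
    rcases Nat.eq_zero_or_pos (G.dist u v) with h0 | hpos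
    · obtain rfl : u = v := hG.dist_eq_zero_iff.1 h0
      refine phaseRun_known_mono (Nat.zero_le r) u ?_
      simp [phaseRun, sourceTokens, hu, distToken]
    · obtain ⟨h, hh⟩ := Nat.exists_eq_succ_of_ne_zero hpos.ne'
      obtain ⟨y, hvy, hy⟩ := hG.exists_adj_dist_eq hh
      obtain ⟨s, rfl⟩ : ∃ s, r = s + 1 := ⟨r - 1, by omega⟩
      -- From `v` to `y` the token of `u` drops by exactly `N` and every other one by at most `N`,
      -- so the rank of `u` does not grow.
      have hrank : (R.filter fun u' => distToken N G ident y u' < distToken N G ident y u) ⊆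
          R.filter fun u' => distToken N G ident v u' < distToken N G ident v u := by
        intro u' hu'
        simp only [Finset.mem_filter] at hu' ⊢
        refine ⟨hu'.1, ?_⟩
        have h1 := hG.dist_le_succ_of_adj (u := u') hvy
        have h2 : N * G.dist u' v ≤ N * (G.dist u' y + 1) := Nat.mul_le_mul_left _ h1
        have h3 := hu'.2
        unfold distToken at h3 ⊢
        rw [hh, Nat.succ_eq_add_one, Nat.mul_succ]
        rw [Nat.mul_succ] at h2
        rw [hy] at h3
        omega
      have h4 := Finset.card_le_card hrank
      have hs := (IH s (by omega) (hb' s (by omega)) y u hu (by omega)).2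
      have h5 := mem_known_of_mem_sent hvy hs
      have h6 : distToken N G ident y u < 2 ^ b := by
        have h7 : N * G.dist u y ≤ N * s := Nat.mul_le_mul_left _ (by omega)
        have h8 := hid u
        have h9 := hb' s (by omega)
        unfold distToken
        rw [Nat.mul_succ] at h9
        omega
      rw [Nat.mod_eq_of_lt h6] at h5
      have h10 : distToken N G ident v u = distToken N G ident y u + N := by
        unfold distToken
        rw [hh, hy, Nat.mul_succ]
        omega
      rwa [h10]
  refine ⟨hknown, ?_⟩
  by_cases hsent : distToken N G ident v u ∈ (phaseRun b N G (sourceTokens ident R) r v).sent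
  · exact phaseRun_sent_mono r.le_succ v hsent
  have hcur : ∀ w ∈ R, ∀ d, G.dist w v ≤ d → distToken N G ident v w ≤ N * d + ident w :=
    fun w _ d hd => Nat.add_le_add_right (Nat.mul_le_mul_left _ hd) _
  obtain ⟨ρ, hρle, hρ⟩ := exists_pendingToken_le (N := N) hknown hsent (by
    intro τ' hτ' hmod
    obtain ⟨w, hw, d, -, hd, rfl⟩ := bfs_sound hG hid (hb' r le_rfl) hτ'
    rw [distToken, mod_of_token hid, mod_of_token hid] at hmod
    obtain rfl := hinj hmod
    exact hcur w hw d hd)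
  rw [mem_phaseRun_succ_sent]
  right
  obtain ⟨⟨hρk, hρs, hρc⟩, -⟩ := pendingToken_eq_some_iff.1 hρ
  rcases hρle.eq_or_lt with rfl | hlt
  · exact hρ
  exfalso
  obtain ⟨w, hw, d, -, hd, rfl⟩ := bfs_sound hG hid (hb' r le_rfl) hρk
  -- Something smaller is pending, from a source `w` of lower rank. By induction the final token of
  -- `w` has been sent, and a pending token of `w` cannot exceed it, so it equals it: a
  -- contradiction.
  have hwlt : distToken N G ident v w < distToken N G ident v u := (hcur w hw d hd).trans_lt hlt
  have hlt2 : (R.filter fun u' => distToken N G ident v u' < distToken N G ident v w).card <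
      (R.filter fun u' => distToken N G ident v u' < distToken N G ident v u).card := by
    refine Finset.card_lt_card ((Finset.ssubset_iff_of_subset ?_).2
      ⟨w, by simp [hw, hwlt], by simp⟩)
    intro x hx
    simp only [Finset.mem_filter] at hx ⊢
    exact ⟨hx.1, hx.2.trans hwlt⟩
  have hdist := dist_le_of_distToken_le hid hwlt.le
  have hws := (IH (r - 1) (by omega) (hb' _ (by omega)) v w hw (by omega)).2
  rw [Nat.sub_add_cancel (by omega)] at hws
  have heq : N * d + ident w = distToken N G ident v w := by
    refine le_antisymm (hρc _ (phaseRun_sent_subset_known _ _ hws) ?_) (hcur w hw d hd)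
    rw [distToken, mod_of_token hid, mod_of_token hid]
  exact hρs (heq ▸ hws)

/-- The token of the nearest source is the smallest token known after a breadth-first search. -/
theorem bfs_nearest (hG : G.Connected) (hinj : Function.Injective ident)
    (hid : ∀ v, ident v < N) {D r : ℕ} (hb : N * (r + 1) ≤ 2 ^ b) (hD : ∀ u v, G.dist u v ≤ D)
    (hr : D ≤ r) (hR : R.Nonempty) (v : V) :
    ∃ u ∈ R, (∀ u' ∈ R, G.dist u v ≤ G.dist u' v) ∧
      sInf ((phaseRun b N G (sourceTokens ident R) r v).known : Set ℕ) =
        N * G.dist u v + ident u := by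
  obtain ⟨u, hu, hmin⟩ := Finset.exists_min_image R (distToken N G ident v) hR
  refine ⟨u, hu, fun u' hu' => dist_le_of_distToken_le hid (hmin u' hu'), ?_⟩
  have hk := (bfs_progress hG hinj hid r hb v u hu (by
    rw [Finset.filter_eq_empty_iff.2 fun x hx => not_lt.2 (hmin x hx)]
    simpa using (hD u v).trans hr)).1
  refine le_antisymm (Nat.sInf_le hk) (le_csInf ⟨_, hk⟩ fun τ hτ => ?_)
  obtain ⟨w, hw, d, -, hd, rfl⟩ := bfs_sound hG hid hb hτ
  exact (hmin w hw).trans (Nat.add_le_add_right (Nat.mul_le_mul_left _ hd) _)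

/-- The largest distance of a source, read off from the tokens known after a breadth-first
search. -/
noncomputable def farthest (N : ℕ) (F : Finset ℕ) : ℕ :=
  (F.image (· % N)).sup fun a => sInf {τ | τ ∈ F ∧ τ % N = a} / N

theorem farthest_bfs (hG : G.Connected) (hinj : Function.Injective ident)
    (hid : ∀ v, ident v < N) {D r K : ℕ} (hb : N * (r + 1) ≤ 2 ^ b)
    (hD : ∀ u v, G.dist u v ≤ D) (hR : R.card ≤ K) (hr : D + K ≤ r) (v : V) :
    farthest N (phaseRun b N G (sourceTokens ident R) r v).known =
      R.sup fun u => G.dist u v := by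
  have hk : ∀ u ∈ R, distToken N G ident v u ∈
      (phaseRun b N G (sourceTokens ident R) r v).known := fun u hu =>
    (bfs_progress hG hinj hid r hb v u hu (le_trans (Nat.add_le_add (hD u v)
      ((Finset.card_le_card (Finset.filter_subset _ _)).trans hR)) hr)).1
  have himage : (phaseRun b N G (sourceTokens ident R) r v).known.image (· % N) =
      R.image ident := by
    ext a
    simp only [Finset.mem_image]
    constructor
    · rintro ⟨τ, hτ, rfl⟩
      obtain ⟨w, hw, d, -, hd, rfl⟩ := bfs_sound hG hid hb hτ
      exact ⟨w, hw, (mod_of_token hid d w).symm⟩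
    · rintro ⟨u, hu, rfl⟩
      exact ⟨_, hk u hu, mod_of_token hid _ u⟩
  unfold farthest
  rw [himage, Finset.sup_image]
  refine Finset.sup_congr rfl fun u hu => ?_
  have hmem : distToken N G ident v u ∈
      {τ | τ ∈ (phaseRun b N G (sourceTokens ident R) r v).known ∧ τ % N = ident u} :=
    ⟨hk u hu, mod_of_token hid _ u⟩
  have : sInf {τ | τ ∈ (phaseRun b N G (sourceTokens ident R) r v).known ∧ τ % N = ident u} =
      distToken N G ident v u := by
    refine le_antisymm (Nat.sInf_le hmem) (le_csInf ⟨_, hmem⟩ ?_)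
    rintro τ ⟨hτ, hmod⟩
    obtain ⟨w, hw, d, -, hd, rfl⟩ := bfs_sound hG hid hb hτ
    rw [mod_of_token hid] at hmod
    obtain rfl := hinj hmod
    exact Nat.add_le_add_right (Nat.mul_le_mul_left _ hd) _
  rw [Function.comp_apply, this, distToken, div_of_token hid]

end BFS

/-! ### The geometry behind the ratio 3/5 -/

/-- The combinatorial heart of the approximation.  `X` is a set of samples, `w` is a vertex of `S`
that is as far from the projections of `X` to `S` as `s₀`, and `R` contains the projections to `T` of
the vertices close to `w`. -/
theorem three_mul_dist_div_five_le {V : Type} {G : SimpleGraph V} (hG : G.Connected)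
    {S T : Finset V} (hST : ∀ v, v ∉ S ↔ v ∈ T) {s₀ t₀ w : V} (ht₀ : t₀ ∈ T)
    (hs₀ : s₀ ∈ S) (hwS : w ∈ S) {projS projT : V → V}
    (hprojS : ∀ v, ∀ s ∈ S, G.dist (projS v) v ≤ G.dist s v)
    (hprojT : ∀ v, ∀ t ∈ T, G.dist (projT v) v ≤ G.dist t v) {X R : Finset V}
    (hw : ∀ M, (∀ x ∈ X, M < G.dist (projS x) s₀) → ∀ x ∈ X, M < G.dist (projS x) w)
    (hR : ∀ M, (∀ x ∈ X, M < G.dist w x + G.dist (projS x) x) →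
      ∀ v, G.dist w v + G.dist (projS v) v ≤ M → projT v ∈ R) {E : ℕ}
    (hEX : ∀ x ∈ X, ∀ t ∈ T, G.dist (projS x) t ≤ E) (hEw : ∀ t ∈ T, G.dist w t ≤ E)
    (hER : ∀ r ∈ R, ∀ s ∈ S, G.dist r s ≤ E) : 3 * G.dist s₀ t₀ / 5 ≤ E := by
  by_contra! hE
  -- The rounding is exact: `L ≤ M + a` excludes the crossings into `T`, and `2 * L ≤ 3 * M` yields
  -- the final contradiction.
  obtain ⟨L, hL⟩ : ∃ L, L = 3 * G.dist s₀ t₀ / 5 := ⟨_, rfl⟩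
  obtain ⟨M, hM⟩ : ∃ M, M = G.dist s₀ t₀ - L := ⟨_, rfl⟩
  obtain ⟨a, ha⟩ : ∃ a, a = M / 2 := ⟨_, rfl⟩
  have hX : ∀ x ∈ X, M < G.dist (projS x) s₀ := by
    intro x hx
    by_contra! hcon
    have h1 := hEX x hx t₀ ht₀
    have h2 := hG.dist_triangle (u := s₀) (v := projS x) (w := t₀)
    rw [G.dist_comm (u := s₀) (v := projS x)] at h2
    omega
  -- By the triangle inequality the key of a sample is at least the distance from `w` to its
  -- projection, hence above `M`; so `hR` applies.
  have hkey : ∀ v, G.dist w v + G.dist (projS v) v ≤ M → M < G.dist (projT v) t₀ := by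
    intro v hv
    have hmem := hR M (fun x hx => by
      have h1 := hw M hX x hx
      have h2 := hG.dist_triangle (u := projS x) (v := x) (w := w)
      rw [G.dist_comm (u := x) (v := w)] at h2
      omega) v hv
    have h1 := hER _ hmem s₀ hs₀
    have h2 := hG.dist_triangle (u := s₀) (v := projT v) (w := t₀)
    rw [G.dist_comm (u := s₀) (v := projT v)] at h2
    omega
  have hprojT_self : ∀ t ∈ T, projT t = t := fun t ht =>
    hG.dist_eq_zero_iff.1 (Nat.le_zero.1 (by simpa using hprojT t t ht))
  obtain ⟨p, hp⟩ := hG.exists_walk_length_eq_dist w t₀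
  have hℓ := hEw t₀ ht₀
  obtain ⟨ℓ, hℓdef⟩ : ∃ ℓ, ℓ = G.dist w t₀ := ⟨_, rfl⟩
  have hfrom : ∀ i, G.dist w (p.getVert i) ≤ i := fun i =>
    (SimpleGraph.dist_le (p.take i)).trans (by rw [SimpleGraph.Walk.take_length]; exact min_le_left _ _)
  have hto : ∀ i, G.dist (p.getVert i) t₀ ≤ ℓ - i := fun i =>
    (SimpleGraph.dist_le (p.drop i)).trans (by rw [SimpleGraph.Walk.drop_length, hp, hℓdef])
  -- As `w` lies in `S`, the projection of `v` to `S` is at most as far as `w`, so the key of `v` is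
  -- at most twice its distance from `w`.
  have hnear : ∀ v ∈ T, 2 * G.dist w v ≤ M → M < G.dist v t₀ := by
    intro v hv h
    have h1 := hprojS v w hwS
    have h2 := hkey v (by omega)
    rwa [hprojT_self v hv] at h2
  have hprojS_self : ∀ s ∈ S, G.dist (projS s) s = 0 := fun s hs =>
    Nat.le_zero.1 (by simpa using hprojS s s hs)
  have hnearS : ∀ i ≤ M, p.getVert i ∈ S →
      ∀ t ∈ T, M < G.dist t (p.getVert i) + (ℓ - i) := by
    intro i hi hiS t ht
    have h1 := hkey (p.getVert i) (by
      rw [hprojS_self _ hiS]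
      exact (hfrom i).trans hi)
    have h2 := hprojT (p.getVert i) t ht
    have h3 := hG.dist_triangle (u := projT (p.getVert i)) (v := p.getVert i) (w := t₀)
    have h4 := hto i
    omega
  have haℓ : a < ℓ := by
    by_contra! hcon
    have := hnear t₀ ht₀ (by omega)
    simp at this
  have hstart : p.getVert a ∈ S := by
    by_contra hcon
    have h1 := hnear _ ((hST _).1 hcon) (by have := hfrom a; omega)
    have h2 := hto a
    omega
  -- If the path left `S` right after step `i`, the next vertex would be at distance one from it,
  -- and `hnearS` would give `M ≤ ℓ - i ≤ ℓ - a < L - a ≤ M`.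
  have hall : ∀ i, a ≤ i → i ≤ M → i ≤ ℓ → p.getVert i ∈ S := by
    intro i hai
    induction i, hai using Nat.le_induction with
    | base => exact fun _ _ => hstart
    | succ i hai ih =>
      intro hiM hiℓ
      by_contra hcon
      have h1 := hnearS i (by omega) (ih (by omega) (by omega)) _ ((hST _).1 hcon)
      have h2 := SimpleGraph.dist_eq_one_iff_adj.2 (p.adj_getVert_succ (i := i) (by omega)).symm
      omega
  rcases le_total ℓ M with h | h
  · have h1 := hall ℓ haℓ.le h le_rfl
    rw [hℓdef, ← hp, p.getVert_length] at h1
    exact (hST t₀).2 ht₀ h1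
  -- With `t₀` as the competitor, `hnearS` forces `M < 2 * (ℓ - M)`, which contradicts `ℓ < L`.
  · have h1 := hnearS M le_rfl (hall M (by omega) le_rfl h) t₀ ht₀
    have h2 := hto M
    rw [G.dist_comm] at h2
    omega

/-! ### Random samples and concentration bounds -/

section Sampling

variable {V : Type} [Fintype V] [DecidableEq V] {m : ℕ}

/-- The sampled vertices: those whose random bits are all `true`. -/
def sampled (ω : V → Fin m → Bool) : Finset V :=
  Finset.univ.filter fun v => ω v = fun _ => true

theorem card_filter_disjoint_sampled_mul (Y : Finset V) :
    (Finset.univ.filter fun ω : V → Fin m → Bool => Disjoint (sampled ω) Y).card *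
      (2 ^ m) ^ Y.card = (2 ^ m - 1) ^ Y.card * Fintype.card (V → Fin m → Bool) := by
  have hset : (Finset.univ.filter fun ω : V → Fin m → Bool => Disjoint (sampled ω) Y) =
      Fintype.piFinset fun v => if v ∈ Y then Finset.univ.erase (fun _ => true) else Finset.univ := by
    ext ω
    simp only [Finset.mem_filter, Finset.mem_univ, true_and, Fintype.mem_piFinset,
      Finset.disjoint_left, sampled]
    refine forall_congr' fun v => ?_
    split_ifs with h <;> simp [h]
  have hc : Fintype.card (Fin m → Bool) = 2 ^ m := by simp
  rw [hset, Fintype.card_piFinset, Fintype.card_fun, hc]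
  have h1 : ∀ v, (if v ∈ Y then (Finset.univ.erase (fun _ : Fin m => true)) else Finset.univ).card =
      if v ∈ Y then 2 ^ m - 1 else 2 ^ m := by
    intro v
    split_ifs
    · rw [Finset.card_erase_of_mem (Finset.mem_univ _), Finset.card_univ, hc]
    · rw [Finset.card_univ, hc]
  simp only [h1]
  rw [Finset.prod_ite, Finset.prod_const, Finset.prod_const, mul_assoc, ← pow_add,
    ← Finset.card_univ (α := V)]
  congr 2
  · simp
  · rw [← Finset.card_filter_add_card_filter_not (s := Finset.univ) (fun v : V => v ∈ Y)]
    simp [add_comm]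

/-- The exponential moment of the sample size, as a count: one bit string of each node has weight 2
and the others weight 1. Markov's inequality then bounds the upper tail. -/
theorem sum_two_pow_card_sampled :
    ∑ ω : V → Fin m → Bool, 2 ^ (sampled ω).card = (2 ^ m + 1) ^ Fintype.card V := by
  have h1 : ∀ ω : V → Fin m → Bool, 2 ^ (sampled ω).card =
      ∏ v, if ω v = (fun _ => true) then 2 else 1 := by
    intro ω
    rw [Finset.prod_ite]
    simp [sampled]
  simp only [h1]
  have h2 := Finset.prod_univ_sum (fun _ : V => (Finset.univ : Finset (Fin m → Bool)))
    (fun _ c => if c = (fun _ => true) then (2 : ℕ) else 1)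
  rw [Fintype.piFinset_univ] at h2
  rw [← h2, Finset.prod_const, Finset.card_univ]
  congr 1
  rw [← Finset.add_sum_erase _ _ (Finset.mem_univ (fun _ => true))]
  rw [if_pos rfl, Finset.sum_congr rfl (fun c hc => if_neg (Finset.ne_of_mem_erase hc))]
  simp
  have : 0 < 2 ^ m := by positivity
  omega

theorem card_filter_lt_card_sampled_mul_le (K : ℕ) :
    (Finset.univ.filter fun ω : V → Fin m → Bool => K < (sampled ω).card).card * 2 ^ (K + 1) ≤
      (2 ^ m + 1) ^ Fintype.card V := by
  rw [← sum_two_pow_card_sampled, ← smul_eq_mul, ← Finset.sum_const]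
  refine le_trans (Finset.sum_le_sum fun ω hω => ?_)
    (Finset.sum_le_sum_of_subset (Finset.filter_subset _ _))
  exact Nat.pow_le_pow_right (by norm_num) (Finset.mem_filter.1 hω).2

/-- The number of random bits per node. -/
def sampleBits (n : ℕ) : ℕ := Nat.log 2 n / 2

/-- A bound for the number of samples, and for the number of vertices in an unsampled ball. -/
def sampleBound (k n : ℕ) : ℕ := min n (2 ^ sampleBits n * ((k + 7) * Nat.clog 2 n))

theorem coinMeasure_real_setOf (m : ℕ) (p : (V → Fin m → Bool) → Prop) [DecidablePred p] :
    (coinMeasure V m).real {ω | p ω} =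
      (Finset.univ.filter p).card / (Fintype.card (V → Fin m → Bool) : ℝ) := by
  classical
  have hms : MeasurableSet {ω | p ω} := (Set.toFinite _).measurableSet
  rw [Measure.real, coinMeasure, PMF.toMeasure_uniformOfFintype_apply _ hms]
  rw [ENNReal.toReal_div, ENNReal.toReal_natCast, ENNReal.toReal_natCast, Fintype.card_subtype]
  rfl

/-- With the next lemma this places `2 ^ sampleBits n` within a factor two of $\sqrt n$. -/
theorem two_pow_sampleBits_sq_le {n : ℕ} (hn : n ≠ 0) : (2 ^ sampleBits n) ^ 2 ≤ n := by
  rw [← pow_mul]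
  exact (Nat.pow_le_pow_right (by norm_num) (Nat.div_mul_le_self _ _)).trans
    (Nat.pow_log_le_self 2 hn)

theorem lt_four_mul_two_pow_sampleBits_sq (n : ℕ) : n < 4 * (2 ^ sampleBits n) ^ 2 := by
  have h1 := Nat.lt_pow_succ_log_self (b := 2) (by norm_num) n
  refine h1.trans_le ?_
  rw [← pow_mul, show 4 = 2 ^ 2 by norm_num, ← pow_add]
  refine Nat.pow_le_pow_right (by norm_num) ?_
  unfold sampleBits
  omega

/-- With $q=2^m$ the moment is $(1+1/q)^n\le e^{n/q}\le e^{4q}\le 2^{6q}$. If the bound is capped at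
`n`, there is nothing to prove. -/
theorem card_oversampled_le (k : ℕ) (hn : 2 ≤ Fintype.card V) :
    ((Finset.univ.filter fun ω : V → Fin (sampleBits (Fintype.card V)) → Bool =>
      sampleBound k (Fintype.card V) < (sampled ω).card).card : ℝ) *
        (2 * (Fintype.card V : ℝ) ^ k) ≤
      Fintype.card (V → Fin (sampleBits (Fintype.card V)) → Bool) := by
  obtain ⟨n, hnV⟩ : ∃ n, n = Fintype.card V := ⟨_, rfl⟩
  rw [← hnV] at hn ⊢
  have hcount := card_filter_lt_card_sampled_mul_le (V := V) (m := sampleBits n) (sampleBound k n)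
  rw [← hnV] at hcount
  have hΩ : Fintype.card (V → Fin (sampleBits n) → Bool) = (2 ^ sampleBits n) ^ n := by
    simp [hnV]
  have hlt := lt_four_mul_two_pow_sampleBits_sq n
  have hnl : n ≤ 2 ^ Nat.clog 2 n := Nat.le_pow_clog (by norm_num) n
  have hl : 1 ≤ Nat.clog 2 n := Nat.clog_pos (by norm_num) hn
  have hq : 1 ≤ 2 ^ sampleBits n := Nat.one_le_two_pow
  rw [hΩ]
  generalize hKdef : sampleBound k n = K at *
  rcases le_total n (2 ^ sampleBits n * ((k + 7) * Nat.clog 2 n)) with hK | hK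
  · have hK' : K = n := by rw [← hKdef, sampleBound, min_eq_left hK]
    have : (Finset.univ.filter fun ω : V → Fin (sampleBits n) → Bool =>
        K < (sampled ω).card) = ∅ := by
      rw [Finset.filter_eq_empty_iff]
      intro ω _
      exact not_lt.2 ((Finset.card_le_univ _).trans (by omega))
    rw [this]
    simp
  · have hK' : K = 2 ^ sampleBits n * ((k + 7) * Nat.clog 2 n) := by
      rw [← hKdef, sampleBound, min_eq_right hK]
    generalize (Finset.univ.filter fun ω : V → Fin (sampleBits n) → Bool =>
      K < (sampled ω).card).card = a at *
    generalize 2 ^ sampleBits n = q at *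
    generalize Nat.clog 2 n = l at *
    -- This is what the constant 7 in `sampleBound` provides: `6 * q` absorbs the moment and `k * l`
    -- the factor $n^k$.
    have hKge : 6 * q + k * l ≤ K := by
      rw [hK']
      have h1 : 1 * (k * l) ≤ q * (k * l) := Nat.mul_le_mul_right _ hq
      have h2 : q * 7 * 1 ≤ q * 7 * l := Nat.mul_le_mul_left _ hl
      nlinarith
    have hqR : (0 : ℝ) < q := by exact_mod_cast hq
    have hexp4 : Real.exp 4 ≤ 2 ^ 6 := by
      have : Real.exp 4 = Real.exp 1 ^ 4 := by rw [← Real.exp_nat_mul]; norm_num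
      rw [this]
      calc Real.exp 1 ^ 4 ≤ 2.7182818286 ^ 4 :=
            pow_le_pow_left₀ (Real.exp_pos 1).le Real.exp_one_lt_d9.le 4
        _ ≤ 2 ^ 6 := by norm_num
    have hpow : ((q : ℝ) + 1) ^ n ≤ (q : ℝ) ^ n * 2 ^ (6 * q) := by
      have h1 : ((q : ℝ) + 1) = q * (1 / q + 1) := by field_simp; ring
      rw [h1, mul_pow]
      refine mul_le_mul_of_nonneg_left ?_ (by positivity)
      calc (1 / (q : ℝ) + 1) ^ n ≤ Real.exp (1 / q) ^ n :=
            pow_le_pow_left₀ (by positivity) (Real.add_one_le_exp _) n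
        _ = Real.exp (n / q) := by rw [← Real.exp_nat_mul]; congr 1; ring
        _ ≤ Real.exp (q * 4) := by
          refine Real.exp_le_exp.2 ?_
          rw [div_le_iff₀ hqR]
          have : (n : ℝ) ≤ 4 * (q : ℝ) ^ 2 := by exact_mod_cast hlt.le
          linarith
        _ = Real.exp 4 ^ q := by rw [Real.exp_nat_mul]
        _ ≤ (2 ^ 6) ^ q := pow_le_pow_left₀ (Real.exp_pos 4).le hexp4 q
        _ = 2 ^ (6 * q) := by rw [pow_mul]
    have hnk : 2 * (n : ℝ) ^ k * 2 ^ (6 * q) ≤ 2 ^ (K + 1) := by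
      have h1 : (n : ℝ) ^ k ≤ 2 ^ (k * l) := by
        rw [mul_comm, pow_mul]
        exact pow_le_pow_left₀ (Nat.cast_nonneg n) (by exact_mod_cast hnl) k
      calc 2 * (n : ℝ) ^ k * 2 ^ (6 * q) ≤ 2 * 2 ^ (k * l) * 2 ^ (6 * q) := by gcongr
        _ = 2 ^ (6 * q + k * l + 1) := by ring
        _ ≤ 2 ^ (K + 1) := pow_le_pow_right₀ (by norm_num) (by omega)
    have hc : (a : ℝ) * 2 ^ (K + 1) ≤ ((q : ℝ) + 1) ^ n := by exact_mod_cast hcount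
    have hpos : (0 : ℝ) < 2 ^ (6 * q) := by positivity
    refine le_of_mul_le_mul_right ?_ hpos
    calc (a : ℝ) * (2 * (n : ℝ) ^ k) * 2 ^ (6 * q) = a * (2 * (n : ℝ) ^ k * 2 ^ (6 * q)) := by ring
      _ ≤ a * 2 ^ (K + 1) := by gcongr
      _ ≤ _ := hc.trans hpow
      _ = _ := by push_cast; ring

/-- The set is missed with probability $(1-1/q)^{|Y|}\le e^{-|Y|/q}\le n^{-(k+7)}$. The spare power
of $n$ pays for the union bound over `w`. -/
theorem card_unsampled_le (k : ℕ) (hn : 2 ≤ Fintype.card V) (Y : Finset V)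
    (hY : sampleBound k (Fintype.card V) < Y.card) :
    ((Finset.univ.filter fun ω : V → Fin (sampleBits (Fintype.card V)) → Bool =>
      Disjoint (sampled ω) Y).card : ℝ) * (2 * (Fintype.card V : ℝ) ^ (k + 1)) ≤
      Fintype.card (V → Fin (sampleBits (Fintype.card V)) → Bool) := by
  obtain ⟨n, hnV⟩ : ∃ n, n = Fintype.card V := ⟨_, rfl⟩
  have hYn : Y.card ≤ n := hnV ▸ Finset.card_le_univ Y
  rw [← hnV] at hn hY ⊢
  have hcount := card_filter_disjoint_sampled_mul (m := sampleBits n) Y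
  have hnl : n ≤ 2 ^ Nat.clog 2 n := Nat.le_pow_clog (by norm_num) n
  have hq : 1 ≤ 2 ^ sampleBits n := Nat.one_le_two_pow
  have hK : 2 ^ sampleBits n * ((k + 7) * Nat.clog 2 n) ≤ Y.card := by
    unfold sampleBound at hY
    omega
  generalize Fintype.card (V → Fin (sampleBits n) → Bool) = Ω at *
  generalize (Finset.univ.filter fun ω : V → Fin (sampleBits n) → Bool =>
      Disjoint (sampled ω) Y).card = a at *
  generalize 2 ^ sampleBits n = q at *
  generalize Nat.clog 2 n = l at *
  generalize Y.card = y at *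
  have hqR : (0 : ℝ) < q := by exact_mod_cast hq
  have hc : (a : ℝ) * (q : ℝ) ^ y = ((q : ℝ) - 1) ^ y * Ω := by
    rw [← Nat.cast_one, ← Nat.cast_sub hq]
    exact_mod_cast hcount
  have h1 : ((q : ℝ) - 1) ^ y ≤ (q : ℝ) ^ y * Real.exp (-(y / q)) := by
    have h2 : ((q : ℝ) - 1) = q * (-(1 / q) + 1) := by field_simp; ring
    have h3 : (0 : ℝ) ≤ -(1 / q) + 1 := by
      have : (1 : ℝ) / q ≤ 1 := by
        rw [div_le_one hqR]
        exact_mod_cast hq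
      linarith
    rw [h2, mul_pow]
    refine mul_le_mul_of_nonneg_left ?_ (by positivity)
    calc (-(1 / (q : ℝ)) + 1) ^ y ≤ Real.exp (-(1 / q)) ^ y :=
          pow_le_pow_left₀ h3 (Real.add_one_le_exp _) y
      _ = Real.exp (-(y / q)) := by rw [← Real.exp_nat_mul]; congr 1; ring
  have h4 : 2 * (n : ℝ) ^ (k + 1) ≤ Real.exp (y / q) := by
    have h5 : (n : ℝ) ≤ Real.exp l := by
      calc (n : ℝ) ≤ 2 ^ l := by exact_mod_cast hnl
        _ ≤ Real.exp 1 ^ l := pow_le_pow_left₀ (by norm_num)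
            (by have := Real.add_one_le_exp (1 : ℝ); linarith) l
        _ = Real.exp l := by rw [← Real.exp_nat_mul, mul_one]
    have hnR : (2 : ℝ) ≤ n := by exact_mod_cast hn
    calc 2 * (n : ℝ) ^ (k + 1) ≤ n * (n : ℝ) ^ (k + 1) := by gcongr
      _ = (n : ℝ) ^ (k + 2) := by ring
      _ ≤ (n : ℝ) ^ (k + 7) := pow_le_pow_right₀ (by linarith) (by omega)
      _ ≤ Real.exp l ^ (k + 7) := pow_le_pow_left₀ (by linarith) h5 _
      _ = Real.exp ((k + 7 : ℕ) * l) := by rw [← Real.exp_nat_mul]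
      _ ≤ Real.exp (y / q) := by
        refine Real.exp_le_exp.2 ?_
        rw [le_div_iff₀ hqR]
        have : ((q * ((k + 7) * l) : ℕ) : ℝ) ≤ y := by exact_mod_cast hK
        push_cast at this ⊢
        linarith
  have h6 : (a : ℝ) ≤ Real.exp (-(y / q)) * Ω := by
    refine le_of_mul_le_mul_right ?_ (pow_pos hqR y)
    rw [hc]
    calc ((q : ℝ) - 1) ^ y * Ω ≤ ((q : ℝ) ^ y * Real.exp (-(y / q))) * Ω := by gcongr
      _ = _ := by ring
  calc (a : ℝ) * (2 * (n : ℝ) ^ (k + 1)) ≤ (Real.exp (-(y / q)) * Ω) * Real.exp (y / q) := by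
        gcongr
    _ = (Real.exp (-(y / q)) * Real.exp (y / q)) * Ω := by ring
    _ = Ω := by rw [← Real.exp_add]; simp

/-- The samples are few, and the vertices of small key are few whenever no sample is among them. -/
def GoodSample (K : ℕ) (κ : V → V → ℕ) (X : Finset V) : Prop :=
  X.card ≤ K ∧ ∀ w M, (∀ x ∈ X, M < κ w x) → (Finset.univ.filter fun v => κ w v ≤ M).card ≤ K

theorem le_coinMeasure_goodSample (k : ℕ) (hn : 2 ≤ Fintype.card V) (κ : V → V → ℕ) :
    1 - 1 / (Fintype.card V : ℝ) ^ k ≤ (coinMeasure V (sampleBits (Fintype.card V))).real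
      {ω | GoodSample (sampleBound k (Fintype.card V)) κ (sampled ω)} := by
  classical
  rw [coinMeasure_real_setOf]
  have h0 := card_oversampled_le (V := V) k hn
  have h1 := card_unsampled_le (V := V) k hn
  generalize hm : sampleBits (Fintype.card V) = m at *
  generalize sampleBound k (Fintype.card V) = K at *
  have hw : ∀ w : V, ((Finset.univ.filter fun ω : V → Fin m → Bool =>
      ∃ M, (∀ x ∈ sampled ω, M < κ w x) ∧
        K < (Finset.univ.filter fun v => κ w v ≤ M).card).card : ℝ) *
          (2 * (Fintype.card V : ℝ) ^ (k + 1)) ≤ Fintype.card (V → Fin m → Bool) := by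
    intro w
    -- For fixed `w` the sets grow with `M`, so missing a large one implies missing the smallest
    -- large one. One event per `w` suffices.
    by_cases hex : ∃ M, K < (Finset.univ.filter fun v => κ w v ≤ M).card
    · refine le_trans ?_ (h1 _ (Nat.find_spec hex))
      refine mul_le_mul_of_nonneg_right (Nat.cast_le.2 (Finset.card_le_card fun ω hω => ?_))
        (by positivity)
      obtain ⟨M, hM1, hM2⟩ := (Finset.mem_filter.1 hω).2
      refine Finset.mem_filter.2 ⟨Finset.mem_univ ω, ?_⟩
      rw [Finset.disjoint_left]
      intro x hx hx'
      have := hM1 x hx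
      have := Nat.find_min' hex hM2
      have := (Finset.mem_filter.1 hx').2
      omega
    · push Not at hex
      rw [Finset.filter_eq_empty_iff.2]
      · simp
      · rintro ω - ⟨M, -, hM⟩
        exact absurd hM (not_lt.2 (hex M))
  have hsplit : Fintype.card (V → Fin m → Bool) ≤
      (Finset.univ.filter fun ω : V → Fin m → Bool => GoodSample K κ (sampled ω)).card +
      ((Finset.univ.filter fun ω : V → Fin m → Bool => K < (sampled ω).card).card +
        ∑ w, (Finset.univ.filter fun ω : V → Fin m → Bool =>
          ∃ M, (∀ x ∈ sampled ω, M < κ w x) ∧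
            K < (Finset.univ.filter fun v => κ w v ≤ M).card).card) := by
    rw [← Finset.card_univ]
    refine le_trans (Finset.card_le_card (t := _ ∪ (_ ∪ Finset.univ.biUnion _)) ?_)
      ((Finset.card_union_le _ _).trans (Nat.add_le_add_left ((Finset.card_union_le _ _).trans
        (Nat.add_le_add_left Finset.card_biUnion_le _)) _))
    intro ω _
    by_contra hcon
    simp only [Finset.mem_union, Finset.mem_filter, Finset.mem_univ, true_and,
      Finset.mem_biUnion, not_or, not_exists, not_lt, not_and] at hcon
    exact hcon.1 ⟨hcon.2.1, hcon.2.2⟩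
  have hnR : (0 : ℝ) < Fintype.card V := by
    have : 0 < Fintype.card V := by omega
    exact_mod_cast this
  have hΩ : (0 : ℝ) < Fintype.card (V → Fin m → Bool) := by exact_mod_cast Fintype.card_pos
  have hsum := Finset.sum_le_sum fun w (_ : w ∈ (Finset.univ : Finset V)) => hw w
  rw [← Finset.sum_mul, Finset.sum_const, Finset.card_univ, nsmul_eq_mul] at hsum
  have hsplitR : (Fintype.card (V → Fin m → Bool) : ℝ) ≤ _ := Nat.cast_le.2 hsplit
  push_cast at hsplitR
  generalize (Fintype.card V : ℝ) = n at *
  rw [le_div_iff₀ hΩ, sub_mul, one_mul, div_mul_eq_mul_div, one_mul, sub_le_iff_le_add,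
    ← sub_le_iff_le_add', le_div_iff₀ (pow_pos hnR k)]
  have hsum' : (∑ w, ((Finset.univ.filter fun ω : V → Fin m → Bool =>
          ∃ M, (∀ x ∈ sampled ω, M < κ w x) ∧
            K < (Finset.univ.filter fun v => κ w v ≤ M).card).card : ℝ)) * (2 * n ^ k) ≤
      Fintype.card (V → Fin m → Bool) := by
    refine le_of_mul_le_mul_right ?_ hnR
    calc _ = _ := by ring
      _ ≤ _ := hsum
      _ = _ := by ring
  have hpos := pow_pos hnR k
  nlinarith

end Sampling

/-! ### The algorithm -/

namespace BichromaticDiameter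

/-- What a node knows at the beginning: its identifier, its colour and whether it is a sample. -/
structure NodeData where
  ident : ℕ
  inS : Bool
  isSample : Bool

/-- The stages of the algorithm: for the guess `2 ^ i` of the diameter, the election of a leader and
the comparison of the leaders, and then the main part, with the results of its phases so far. -/
inductive Stage where
  | elect (i : ℕ)
  | compare (i label : ℕ)
  | main (i : ℕ) (results : List (Finset ℕ))

/-- The phases of the main part: find the nearest vertex of `S` and of `T`, publish the projections
of the samples to `S`, search from these, choose the vertex `w` of `S` that is farthest from them,
search from `w`, publish the projections to `T` of the vertices close to `w`, search from these, and
publish the largest distance found. -/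
noncomputable def mainInstr (n N K T : ℕ) (d : NodeData) : List (Finset ℕ) → PhaseInstr ℕ
  | [] => .phase N T (if d.inS then {d.ident} else ∅)
  | [_] => .phase N T (if d.inS then ∅ else {d.ident})
  | [r₁, _] => .phase 0 T (if d.isSample then {sInf (r₁ : Set ℕ) % N} else ∅)
  | [_, _, r₃] => .phase N T (if d.ident ∈ r₃ then {d.ident} else ∅)
  -- Gossip finds minima, so a distance to be maximised is published as its complement to `n`; the
  -- identifier as low digit breaks ties.
  | [_, _, _, r₄] => .phase 0 T
      (if d.inS then {N * (n - sInf (r₄ : Set ℕ) / N) + d.ident} else ∅)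
  | [_, _, _, _, r₅] => .phase N T (if d.ident = sInf (r₅ : Set ℕ) % N then {d.ident} else ∅)
  | [r₁, r₂, _, _, _, r₆] => .phase 0 T
      {N * (sInf (r₆ : Set ℕ) / N + sInf (r₁ : Set ℕ) / N) + sInf (r₂ : Set ℕ) % N}
  | [_, _, _, _, _, _, r₇] => .phase N T
      (if d.ident ∈ (smallestElts K r₇).image (· % N) then {d.ident} else ∅)
  | [_, _, _, r₄, _, r₆, _, r₈] => .phase 0 T
      {n - if d.inS then farthest N r₈ else max (farthest N r₄) (sInf (r₆ : Set ℕ) / N)}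
  | [_, _, _, _, _, _, _, _, r₉] => .halt (n - sInf (r₉ : Set ℕ))
  -- Never reached: at most nine results are collected.
  | _ => .halt 0

/-- The program of a node. -/
noncomputable def program (c k n : ℕ) : PhaseProgram Bool ℕ where
  Mem := NodeData × Stage
  coins := sampleBits n
  start i x ω := (⟨i, x, decide (ω = fun _ => true)⟩, .elect 0)
  instr m := match m.2 with
    | .elect i => .phase 0 (2 ^ i) {m.1.ident}
    | .compare i l => .phase 0 (2 * 2 ^ i + 4) {l}
    | .main i rs => mainInstr n (n ^ c + 1) (sampleBound k n) (4 * 2 ^ i + sampleBound k n) m.1 rs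
  update m r := (m.1, match m.2 with
    | .elect i => .compare i (sInf (r : Set ℕ))
    | .compare i _ => if r.card ≤ 1 then .main i [] else .elect (i + 1)
    | .main i rs => .main i (rs ++ [r]))

/-! ### Guessing the diameter -/

section Guess

variable {V : Type} [Fintype V] {b : ℕ} {G : SimpleGraph V} {ident : V → ℕ}

/-- The leader that `v` elects when the diameter is guessed to be `2 ^ i`. -/
noncomputable def leader (b : ℕ) (G : SimpleGraph V) (ident : V → ℕ) (i : ℕ) (v : V) : ℕ :=
  sInf ((phaseRun b 0 G (fun v => {ident v}) (2 ^ i + 1) v).known : Set ℕ)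

/-- The leaders that `v` learns when the diameter is guessed to be `2 ^ i`. -/
noncomputable def leaders (b : ℕ) (G : SimpleGraph V) (ident : V → ℕ) (i : ℕ) (v : V) :
    Finset ℕ :=
  (phaseRun b 0 G (fun v => {leader b G ident i v}) (2 * 2 ^ i + 4 + 1) v).known

variable (hG : G.Connected) (hb : ∀ v, ident v < 2 ^ b)
include hG hb

theorem exists_ident_eq_leader (i : ℕ) (v : V) :
    ∃ u, G.dist u v ≤ 2 ^ i + 1 ∧ leader b G ident i v = ident u := by
  have hb' : ∀ v, ∀ τ ∈ ({ident v} : Finset ℕ), τ < 2 ^ b := by simpa using hb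
  have hmem : leader b G ident i v ∈
      (phaseRun b 0 G (fun v => {ident v}) (2 ^ i + 1) v).known :=
    Nat.sInf_mem (s := ((phaseRun b 0 G (fun v => {ident v}) (2 ^ i + 1) v).known : Set ℕ))
      ⟨ident v, phaseRun_known_mono (Nat.zero_le _) v (by simp [phaseRun])⟩
  obtain ⟨u, h1, h2⟩ := gossip_sound hG hb' hmem
  exact ⟨u, h1, by simpa using h2⟩

theorem leader_lt (i : ℕ) (v : V) : ∀ τ ∈ ({leader b G ident i v} : Finset ℕ), τ < 2 ^ b := by
  obtain ⟨u, -, hu⟩ := exists_ident_eq_leader hG hb i v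
  simpa [hu] using hb u

theorem leaders_of_eq {i : ℕ} (h : ∀ u v, leader b G ident i u = leader b G ident i v) (v : V) :
    (leaders b G ident i v).card ≤ 1 := by
  refine Finset.card_le_one_iff_subset_singleton.2 ⟨leader b G ident i v, fun τ hτ => ?_⟩
  obtain ⟨u, -, hu⟩ := gossip_sound hG (leader_lt hG hb i) hτ
  rw [Finset.mem_singleton] at hu ⊢
  rw [hu, h u v]

theorem leader_eq_of_dist_le {i : ℕ} (hD : ∀ u v, G.dist u v ≤ 2 ^ i) (u v : V) :
    leader b G ident i u = leader b G ident i v := by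
  have hb' : ∀ v, ∀ τ ∈ ({ident v} : Finset ℕ), τ < 2 ^ b := by simpa using hb
  unfold leader
  have hne : (Finset.univ.biUnion fun v => ({ident v} : Finset ℕ)).Nonempty :=
    ⟨ident v, by simp⟩
  rw [gossip_sInf hG hb' hD hne (Nat.le_succ _), gossip_sInf hG hb' hD hne (Nat.le_succ _)]

/-- A common leader is within `2 ^ i + 1` of every node. -/
theorem dist_le_of_leader_eq (hinj : Function.Injective ident) {i : ℕ}
    (h : ∀ u v, leader b G ident i u = leader b G ident i v) (u v : V) :
    G.dist u v ≤ 4 * 2 ^ i := by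
  obtain ⟨x, hx, hx'⟩ := exists_ident_eq_leader hG hb i u
  obtain ⟨y, hy, hy'⟩ := exists_ident_eq_leader hG hb i v
  obtain rfl : x = y := hinj (by rw [← hx', ← hy', h u v])
  have h1 := hG.dist_triangle (u := u) (v := x) (w := v)
  rw [G.dist_comm (u := u) (v := x)] at h1
  have h2 : 1 ≤ 2 ^ i := Nat.one_le_two_pow
  omega

/-- Every node must detect a disagreement, as otherwise the nodes would leave the guessing stage at
different times. -/
theorem one_lt_card_leaders (hinj : Function.Injective ident) {i : ℕ}
    (h : ¬ ∀ u v, leader b G ident i u = leader b G ident i v) (v : V) :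
    1 < (leaders b G ident i v).card := by
  obtain ⟨z₀, hz₀⟩ : ∃ z, leader b G ident i z ≠ leader b G ident i v := by
    by_contra! hcon
    exact h fun x y => (hcon x).trans (hcon y).symm
  classical
  obtain ⟨z, hz, hmin⟩ := Finset.exists_min_image
    (Finset.univ.filter fun z => leader b G ident i z ≠ leader b G ident i v) (G.dist v)
    ⟨z₀, by simpa using hz₀⟩
  simp only [Finset.mem_filter, Finset.mem_univ, true_and] at hz hmin
  -- The vertex before `z` on a shortest path from `v` has the same leader as `v`; both are within
  -- `2 ^ i + 1` of it, and one more step reaches `z`.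
  have hdist : G.dist z v ≤ 2 * 2 ^ i + 3 := by
    obtain ⟨x, hx, hx'⟩ := exists_ident_eq_leader hG hb i v
    rcases Nat.eq_zero_or_pos (G.dist v z) with h0 | hpos
    · rw [G.dist_comm]; omega
    obtain ⟨d, hd⟩ := Nat.exists_eq_succ_of_ne_zero hpos.ne'
    obtain ⟨y, hzy, hy⟩ := hG.exists_adj_dist_eq hd
    have hyl : leader b G ident i y = leader b G ident i v := by
      by_contra hcon
      have := hmin y hcon
      omega
    obtain ⟨x', hxy, hxy'⟩ := exists_ident_eq_leader hG hb i y
    obtain rfl : x = x' := hinj (by rw [← hx', ← hxy', hyl])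
    have h1 := hG.dist_triangle (u := v) (v := x) (w := y)
    rw [G.dist_comm (u := v) (v := x)] at h1
    rw [G.dist_comm]
    omega
  have hself : leader b G ident i v ∈ leaders b G ident i v :=
    phaseRun_known_mono (Nat.zero_le _) v (by simp [phaseRun])
  -- With `j = 1`, either the leader of `z` arrives, or two smaller tokens do; each case gives two
  -- distinct leaders.
  rcases gossip_progress hG (leader_lt hG hb i) (Finset.mem_singleton_self _) (2 * 2 ^ i + 3) 1 v
    hdist with h1 | h1
  · exact Finset.one_lt_card.2 ⟨_, phaseRun_known_mono (Nat.le_succ _) v h1, _, hself, hz⟩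
  · refine Nat.lt_of_lt_of_le h1 (Finset.card_le_card ?_)
    exact (Finset.filter_subset _ _).trans (phaseRun_known_mono (Nat.le_succ _) v)

/-- The first successful guess is at most twice the diameter. -/
theorem exists_first_guess (hinj : Function.Injective ident) {D : ℕ} (hD0 : 1 ≤ D)
    (hD : ∀ u v, G.dist u v ≤ D) : ∃ i,
      (∀ j < i, ¬ ∀ u v, leader b G ident j u = leader b G ident j v) ∧
      (∀ u v, leader b G ident i u = leader b G ident i v) ∧
      (∀ u v, G.dist u v ≤ 4 * 2 ^ i) ∧ 2 ^ i ≤ 2 * D := by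
  classical
  have hlarge : ∀ i, D ≤ 2 ^ i → ∀ u v, leader b G ident i u = leader b G ident i v :=
    fun i hi => leader_eq_of_dist_le hG hb fun u v => (hD u v).trans hi
  have hex : ∃ i, ∀ u v, leader b G ident i u = leader b G ident i v :=
    ⟨D, hlarge D Nat.lt_two_pow_self.le⟩
  refine ⟨Nat.find hex, fun j hj => Nat.find_min hex hj, Nat.find_spec hex,
    dist_le_of_leader_eq hG hb hinj (Nat.find_spec hex), ?_⟩
  rcases h : Nat.find hex with _ | j
  · rw [pow_zero]
    omega
  · have h1 : ¬ D ≤ 2 ^ j := fun hj => Nat.find_min hex (m := j) (by omega) (hlarge j hj)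
    rw [pow_succ]
    omega

end Guess

/-- The number of rounds before the guess `2 ^ i`. -/
def guessTime : ℕ → ℕ
  | 0 => 0
  | i + 1 => guessTime i + (2 ^ i + 1) + (2 * 2 ^ i + 4 + 1)

theorem guessTime_le (i : ℕ) : guessTime i ≤ 9 * 2 ^ i := by
  induction i with
  | zero => simp [guessTime]
  | succ i ih =>
    have : 1 ≤ 2 ^ i := Nat.one_le_two_pow
    rw [guessTime, pow_succ]
    omega

/-! ### The run of the algorithm -/

section Reach

variable {V : Type} [Fintype V] {b c k n : ℕ} {G : SimpleGraph V} {ident : V → ℕ} {x : V → Bool}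

/-- The initial data of the nodes. -/
def nodeData {m : ℕ} (ident : V → ℕ) (x : V → Bool) (ω : V → Fin m → Bool) (v : V) : NodeData :=
  ⟨ident v, x v, decide (ω v = fun _ => true)⟩

theorem reachesAt_compare (hinj : Function.Injective ident) {ω : V → Fin (sampleBits n) → Bool}
    {t i : ℕ} (h : (program c k n).ReachesAt b G ident x ω t
      fun v => (nodeData ident x ω v, .elect i)) :
    (program c k n).ReachesAt b G ident x ω (t + (2 ^ i + 1) + (2 * 2 ^ i + 4 + 1)) fun v =>
      (nodeData ident x ω v,
        if (leaders b G ident i v).card ≤ 1 then .main i [] else .elect (i + 1)) :=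
  (h.phase hinj (N := 0) (T := 2 ^ i) (F := fun v => {ident v}) fun _ => rfl).phase hinj
    (N := 0) (T := 2 * 2 ^ i + 4) (F := fun v => {leader b G ident i v}) fun _ => rfl

theorem reachesAt_elect (hG : G.Connected) (hb : ∀ v, ident v < 2 ^ b)
    (hinj : Function.Injective ident) (ω : V → Fin (sampleBits n) → Bool) (i : ℕ)
    (hi : ∀ j < i, ¬ ∀ u v, leader b G ident j u = leader b G ident j v) :
    (program c k n).ReachesAt b G ident x ω (guessTime i)
      fun v => (nodeData ident x ω v, .elect i) := by
  induction i with
  | zero => exact PhaseProgram.reachesAt_zero (P := program c k n) x ω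
  | succ i ih =>
    have h := reachesAt_compare hinj (ih fun j hj => hi j (by omega))
    simpa only [guessTime, not_le.2 (one_lt_card_leaders hG hb hinj (hi i (Nat.lt_succ_self i)) _),
      if_false] using h

theorem reachesAt_main (hG : G.Connected) (hb : ∀ v, ident v < 2 ^ b)
    (hinj : Function.Injective ident) (ω : V → Fin (sampleBits n) → Bool) (i : ℕ)
    (hi : ∀ j < i, ¬ ∀ u v, leader b G ident j u = leader b G ident j v)
    (hi' : ∀ u v, leader b G ident i u = leader b G ident i v) :
    (program c k n).ReachesAt b G ident x ω (guessTime (i + 1))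
      fun v => (nodeData ident x ω v, .main i []) := by
  have h := reachesAt_compare hinj (reachesAt_elect (c := c) (k := k) (x := x) hG hb hinj ω i hi)
  simpa only [guessTime, leaders_of_eq hG hb hi' _, if_true] using h

/-- The result is hidden behind an existential, so that the memories of later phases do not become
nested runs. -/
theorem exists_main_step (hinj : Function.Injective ident) {ω : V → Fin (sampleBits n) → Bool}
    {t i : ℕ} {rs : V → List (Finset ℕ)} {d : V → NodeData}
    (h : (program c k n).ReachesAt b G ident x ω t fun v => (d v, .main i (rs v)))
    {N : ℕ} {F : V → Finset ℕ}
    (hF : ∀ v, mainInstr n (n ^ c + 1) (sampleBound k n) (4 * 2 ^ i + sampleBound k n) (d v) (rs v) =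
      .phase N (4 * 2 ^ i + sampleBound k n) (F v)) : ∃ r : V → Finset ℕ,
    (∀ v, r v = (phaseRun b N G F (4 * 2 ^ i + sampleBound k n + 1) v).known) ∧
    (program c k n).ReachesAt b G ident x ω (t + (4 * 2 ^ i + sampleBound k n + 1))
      fun v => (d v, .main i (rs v ++ [r v])) :=
  ⟨_, fun _ => rfl, h.phase hinj hF⟩

/-- The results of the phases of the main part. -/
theorem exists_main_results (hinj : Function.Injective ident)
    {ω : V → Fin (sampleBits n) → Bool} {t i N K R : ℕ} {d : V → NodeData}
    (hN : N = n ^ c + 1) (hK : K = sampleBound k n) (hR : R = 4 * 2 ^ i + K + 1)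
    (h : (program c k n).ReachesAt b G ident x ω t fun v => (d v, .main i [])) :
    ∃ r₁ r₂ r₃ r₄ r₅ r₆ r₇ r₈ r₉ : V → Finset ℕ,
      (∀ v, r₁ v = (phaseRun b N G
        (fun v => if (d v).inS then {(d v).ident} else ∅) R v).known) ∧
      (∀ v, r₂ v = (phaseRun b N G
        (fun v => if (d v).inS then ∅ else {(d v).ident}) R v).known) ∧
      (∀ v, r₃ v = (phaseRun b 0 G
        (fun v => if (d v).isSample then {sInf (r₁ v : Set ℕ) % N} else ∅) R v).known) ∧
      (∀ v, r₄ v = (phaseRun b N G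
        (fun v => if (d v).ident ∈ r₃ v then {(d v).ident} else ∅) R v).known) ∧
      (∀ v, r₅ v = (phaseRun b 0 G (fun v => if (d v).inS then
        {N * (n - sInf (r₄ v : Set ℕ) / N) + (d v).ident} else ∅) R v).known) ∧
      (∀ v, r₆ v = (phaseRun b N G (fun v => if (d v).ident = sInf (r₅ v : Set ℕ) % N then
        {(d v).ident} else ∅) R v).known) ∧
      (∀ v, r₇ v = (phaseRun b 0 G
        (fun v => {N * (sInf (r₆ v : Set ℕ) / N + sInf (r₁ v : Set ℕ) / N) +
          sInf (r₂ v : Set ℕ) % N}) R v).known) ∧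
      (∀ v, r₈ v = (phaseRun b N G
        (fun v => if (d v).ident ∈ (smallestElts K (r₇ v)).image (· % N) then
          {(d v).ident} else ∅) R v).known) ∧
      (∀ v, r₉ v = (phaseRun b 0 G
        (fun v => {n - if (d v).inS then farthest N (r₈ v)
          else max (farthest N (r₄ v)) (sInf (r₆ v : Set ℕ) / N)}) R v).known) ∧
      (program c k n).ReachesAt b G ident x ω (t + 9 * R)
        fun v => (d v, .main i [r₁ v, r₂ v, r₃ v, r₄ v, r₅ v, r₆ v, r₇ v, r₈ v, r₉ v]) := by
  subst hN hK hR
  obtain ⟨r₁, hr₁, h₁⟩ := exists_main_step hinj h fun _ => rfl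
  obtain ⟨r₂, hr₂, h₂⟩ := exists_main_step hinj h₁ fun _ => rfl
  obtain ⟨r₃, hr₃, h₃⟩ := exists_main_step hinj h₂ fun _ => rfl
  obtain ⟨r₄, hr₄, h₄⟩ := exists_main_step hinj h₃ fun _ => rfl
  obtain ⟨r₅, hr₅, h₅⟩ := exists_main_step hinj h₄ fun _ => rfl
  obtain ⟨r₆, hr₆, h₆⟩ := exists_main_step hinj h₅ fun _ => rfl
  obtain ⟨r₇, hr₇, h₇⟩ := exists_main_step hinj h₆ fun _ => rfl
  obtain ⟨r₈, hr₈, h₈⟩ := exists_main_step hinj h₇ fun _ => rfl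
  obtain ⟨r₉, hr₉, h₉⟩ := exists_main_step hinj h₈ fun _ => rfl
  refine ⟨r₁, r₂, r₃, r₄, r₅, r₆, r₇, r₈, r₉, hr₁, hr₂, hr₃, hr₄, hr₅, hr₆, hr₇, hr₈, hr₉, ?_⟩
  exact h₉.of_time_eq (by ring)

end Reach

/-! ### Correctness of the main part -/

section Correctness

variable {V : Type} {G : SimpleGraph V} {S T : Finset V}

theorem dist_le_stDiam {s t : V} (hs : s ∈ S) (ht : t ∈ T) : G.dist s t ≤ stDiam G S T :=
  (Finset.le_sup (f := G.dist s) ht).trans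
    (Finset.le_sup (f := fun s => T.sup fun t => G.dist s t) hs)

theorem exists_dist_eq_stDiam (hS : S.Nonempty) (hT : T.Nonempty) :
    ∃ s ∈ S, ∃ t ∈ T, G.dist s t = stDiam G S T := by
  obtain ⟨s, hs, hs'⟩ := Finset.exists_mem_eq_sup S hS fun s => T.sup fun t => G.dist s t
  obtain ⟨t, ht, ht'⟩ := Finset.exists_mem_eq_sup T hT (G.dist s)
  exact ⟨s, hs, t, ht, by rw [stDiam, hs', ht']⟩

/-- Here `D` is any bound on the distances; it is later taken as `4 * 2 ^ i`. A good sample leaves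
at most `K` sources in each multi-source search from `Y` or `R`, so `D + K + 1` rounds suffice. -/
theorem main_correct [Fintype V] [DecidableEq V] {b n N K D : ℕ} {ident : V → ℕ} (hG : G.Connected)
    (hinj : Function.Injective ident) (hid : ∀ v, ident v < N)
    (hST : ∀ v, v ∉ S ↔ v ∈ T) (hS : S.Nonempty) (hT : T.Nonempty)
    (hn : ∀ u v, G.dist u v ≤ n) (hD : ∀ u v, G.dist u v ≤ D)
    (hb : N * (D + K + 2) ≤ 2 ^ b) (hb' : N * (2 * n + 1) ≤ 2 ^ b)
    {projS projT : V → V}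
    (hprojS : ∀ v, ∀ s ∈ S, G.dist (projS v) v ≤ G.dist s v)
    (hprojSS : ∀ v, projS v ∈ S) (hprojTT : ∀ v, projT v ∈ T)
    (hprojT : ∀ v, ∀ t ∈ T, G.dist (projT v) v ≤ G.dist t v) {X : Finset V}
    (hX : GoodSample K (fun w v => G.dist w v + G.dist (projS v) v) X)
    {inS smp : V → Bool} (hinS : ∀ v, inS v = true ↔ v ∈ S) (hsmp : ∀ v, smp v = true ↔ v ∈ X)
    {r₁ r₂ r₃ r₄ r₅ r₆ r₇ r₈ r₉ : V → Finset ℕ}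
    (hr₁ : ∀ v, sInf (r₁ v : Set ℕ) = N * G.dist (projS v) v + ident (projS v))
    (hr₂ : ∀ v, sInf (r₂ v : Set ℕ) = N * G.dist (projT v) v + ident (projT v))
    (hr₃ : ∀ v, r₃ v = (phaseRun b 0 G
      (fun v => if smp v then {sInf (r₁ v : Set ℕ) % N} else ∅) (D + K + 1) v).known)
    (hr₄ : ∀ v, r₄ v = (phaseRun b N G
      (fun v => if ident v ∈ r₃ v then {ident v} else ∅) (D + K + 1) v).known)
    (hr₅ : ∀ v, r₅ v = (phaseRun b 0 G
      (fun v => if inS v then {N * (n - sInf (r₄ v : Set ℕ) / N) + ident v} else ∅)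
        (D + K + 1) v).known)
    (hr₆ : ∀ v, r₆ v = (phaseRun b N G
      (fun v => if ident v = sInf (r₅ v : Set ℕ) % N then {ident v} else ∅) (D + K + 1) v).known)
    (hr₇ : ∀ v, r₇ v = (phaseRun b 0 G
      (fun v => {N * (sInf (r₆ v : Set ℕ) / N + sInf (r₁ v : Set ℕ) / N) +
        sInf (r₂ v : Set ℕ) % N}) (D + K + 1) v).known)
    (hr₈ : ∀ v, r₈ v = (phaseRun b N G
      (fun v => if ident v ∈ (smallestElts K (r₇ v)).image (· % N) then {ident v} else ∅)
        (D + K + 1) v).known)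
    (hr₉ : ∀ v, r₉ v = (phaseRun b 0 G
      (fun v => {n - if inS v then farthest N (r₈ v)
        else max (farthest N (r₄ v)) (sInf (r₆ v : Set ℕ) / N)}) (D + K + 1) v).known) :
    ∃ d, 3 * stDiam G S T / 5 ≤ d ∧ d ≤ stDiam G S T ∧ ∀ v, n - sInf (r₉ v : Set ℕ) = d := by
  have hbN : ∀ v, ident v < 2 ^ b := fun v =>
    (hid v).trans_le ((Nat.le_mul_of_pos_right _ (by omega)).trans hb)
  have htok : ∀ a ≤ 2 * n, ∀ v, N * a + ident v < 2 ^ b := by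
    intro a ha v
    have h1 : N * a ≤ N * (2 * n) := Nat.mul_le_mul_left _ ha
    have h2 := hid v
    rw [Nat.mul_succ] at hb'
    omega
  have hrD : D ≤ D + K + 1 := by omega
  have hrK : D + K ≤ D + K + 1 := by omega
  simp only [hr₁, hr₂, div_of_token hid, mod_of_token hid] at hr₃ hr₇
  -- the projections of the samples
  have h₃ : ∀ v, ident v ∈ r₃ v ↔ v ∈ X.image projS := by
    intro v
    rw [hr₃, gossip_all hG ?_ hD ?_ hrK]
    · simp only [Finset.mem_biUnion, Finset.mem_univ, true_and, Finset.mem_image, ← hsmp]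
      refine exists_congr fun x => ?_
      split_ifs with h <;> simp [h, hinj.eq_iff, eq_comm]
    · intro v τ hτ
      split_ifs at hτ
      · rw [Finset.mem_singleton.1 hτ]
        exact hbN _
      · simp at hτ
    · refine le_trans (Finset.card_le_card (t := X.image fun x => ident (projS x)) ?_)
        (Finset.card_image_le.trans hX.1)
      intro τ hτ
      obtain ⟨x, -, hx⟩ := Finset.mem_biUnion.1 hτ
      split_ifs at hx with h
      · exact Finset.mem_image.2 ⟨x, (hsmp x).1 h, (Finset.mem_singleton.1 hx).symm⟩
      · simp at hx
  obtain ⟨Y, hY⟩ : ∃ Y, Y = X.image projS := ⟨_, rfl⟩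
  have hYK : Y.card ≤ K := hY ▸ Finset.card_image_le.trans hX.1
  have hYS : Y ⊆ S := by
    rw [hY]
    exact Finset.image_subset_iff.2 fun x _ => hprojSS x
  simp only [h₃, ← hY] at hr₄
  have hf₄ : ∀ v, farthest N (r₄ v) = Y.sup fun u => G.dist u v := fun v => by
    rw [hr₄]
    exact farthest_bfs hG hinj hid hb hD hYK hrK v
  -- Distances are at most `n`, so truncated subtraction loses nothing: a smaller complement means
  -- that the nearest point of `Y` is at least as far.
  have hnear : ∀ s₀ w, n - sInf (r₄ w : Set ℕ) / N ≤ n - sInf (r₄ s₀ : Set ℕ) / N →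
      ∀ M, (∀ y ∈ Y, M < G.dist y s₀) → ∀ y ∈ Y, M < G.dist y w := by
    intro s₀ w hle M hM y hy
    obtain ⟨u, hu, -, hu'⟩ := bfs_nearest hG hinj hid hb hD hrD ⟨y, hy⟩ s₀
    obtain ⟨u', hu1, hu2, hu3⟩ := bfs_nearest hG hinj hid hb hD hrD ⟨y, hy⟩ w
    have e1 : sInf (r₄ s₀ : Set ℕ) = N * G.dist u s₀ + ident u := by rw [hr₄]; exact hu'
    have e2 : sInf (r₄ w : Set ℕ) = N * G.dist u' w + ident u' := by rw [hr₄]; exact hu3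
    rw [e1, e2, div_of_token hid, div_of_token hid] at hle
    have := hM u hu
    have := hu2 y hy
    have := hn u s₀
    omega
  -- the choice of `w`
  obtain ⟨w, hwS, hw, hw₅⟩ : ∃ w ∈ S,
      (∀ s ∈ S, n - sInf (r₄ w : Set ℕ) / N ≤ n - sInf (r₄ s : Set ℕ) / N) ∧
        ∀ v, sInf (r₅ v : Set ℕ) % N = ident w := by
    obtain ⟨w, hwS, hwmin⟩ := Finset.exists_min_image S
      (fun s => N * (n - sInf (r₄ s : Set ℕ) / N) + ident s) hS
    refine ⟨w, hwS, fun s hs => ?_, fun v => ?_⟩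
    · have := Nat.div_le_div_right (c := N) (hwmin s hs)
      rwa [div_of_token hid, div_of_token hid] at this
    · have hmem : N * (n - sInf (r₄ w : Set ℕ) / N) + ident w ∈ Finset.univ.biUnion fun v =>
          if inS v then {N * (n - sInf (r₄ v : Set ℕ) / N) + ident v} else (∅ : Finset ℕ) :=
        Finset.mem_biUnion.2 ⟨w, Finset.mem_univ w, by simp [(hinS w).2 hwS]⟩
      have : sInf (r₅ v : Set ℕ) = N * (n - sInf (r₄ w : Set ℕ) / N) + ident w := by
        rw [hr₅, gossip_sInf hG ?_ hD ⟨_, hmem⟩ hrD]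
        · refine le_antisymm (Nat.sInf_le hmem) (le_csInf ⟨_, hmem⟩ fun τ hτ => ?_)
          obtain ⟨s, -, hs⟩ := Finset.mem_biUnion.1 hτ
          split_ifs at hs with h
          · rw [Finset.mem_singleton.1 hs]
            exact hwmin s ((hinS s).1 h)
          · simp at hs
        · intro v τ hτ
          split_ifs at hτ
          · rw [Finset.mem_singleton.1 hτ]
            exact htok _ ((Nat.sub_le _ _).trans (by omega)) v
          · simp at hτ
      rw [this, mod_of_token hid]
  simp only [hw₅, hinj.eq_iff] at hr₆
  have h₆ : ∀ v, sInf (r₆ v : Set ℕ) / N = G.dist w v := by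
    intro v
    obtain ⟨u, hu, -, hu'⟩ := bfs_nearest hG hinj hid hb hD hrD (Finset.singleton_nonempty w) v
    obtain rfl := Finset.mem_singleton.1 hu
    have : sInf (r₆ v : Set ℕ) = N * G.dist u v + ident u := by
      have htokens : (fun v => if v = u then ({ident v} : Finset ℕ) else ∅) =
          sourceTokens ident {u} := by
        funext v
        simp only [sourceTokens, Finset.mem_singleton]
      rw [hr₆, ← hu', htokens]
    rw [this, div_of_token hid]
  simp only [h₆] at hr₇ hr₉
  -- the projections to `T` of the vertices close to `w`
  obtain ⟨U, hU⟩ : ∃ U : Finset ℕ, U = Finset.univ.biUnion fun v =>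
    {N * (G.dist w v + G.dist (projS v) v) + ident (projT v)} := ⟨_, rfl⟩
  have hmemU : ∀ τ, τ ∈ U ↔
      ∃ v, τ = N * (G.dist w v + G.dist (projS v) v) + ident (projT v) := by
    intro τ
    simp [hU]
  have h₇ : ∀ v, smallestElts K (r₇ v) = smallestElts K U := by
    intro v
    rw [hr₇, hU]
    refine gossip_smallestElts hG (fun v τ hτ => ?_) hD hrK v
    rw [Finset.mem_singleton.1 hτ]
    have := hn w v
    have := hn (projS v) v
    exact htok _ (by omega) _
  obtain ⟨R, hR⟩ : ∃ R : Finset V, R = Finset.univ.filter fun v =>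
    ident v ∈ (smallestElts K U).image (· % N) := ⟨_, rfl⟩
  have hmemR : ∀ v, ident v ∈ (smallestElts K U).image (· % N) ↔ v ∈ R := by
    intro v
    simp [hR]
  have hRK : R.card ≤ K := by
    rw [← Finset.card_image_of_injective R hinj]
    refine le_trans (Finset.card_le_card (t := (smallestElts K U).image (· % N)) ?_)
      (Finset.card_image_le.trans (card_smallestElts_le K U))
    exact Finset.image_subset_iff.2 fun v hv => (hmemR v).2 hv
  have hRT : R ⊆ T := by
    intro v hv
    obtain ⟨τ, hτ, hτv⟩ := Finset.mem_image.1 ((hmemR v).2 hv)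
    obtain ⟨u, rfl⟩ := (hmemU τ).1 (Finset.mem_filter.1 hτ).1
    rw [mod_of_token hid] at hτv
    rw [← hinj hτv]
    exact hprojTT u
  have hRnear : ∀ M, (∀ x ∈ X, M < G.dist w x + G.dist (projS x) x) →
      ∀ v, G.dist w v + G.dist (projS v) v ≤ M → projT v ∈ R := by
    intro M hM v hv
    rw [← hmemR]
    refine Finset.mem_image.2
      ⟨N * (G.dist w v + G.dist (projS v) v) + ident (projT v), ?_, mod_of_token hid _ _⟩
    refine Finset.mem_filter.2 ⟨(hmemU _).2 ⟨v, rfl⟩, ?_⟩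
    -- Tokens below that of `v` come from vertices of key at most `M`, and the token of `v` itself
    -- is not among them. Hence they number fewer than `K`.
    refine lt_of_lt_of_le ?_ (hX.2 w M hM)
    refine lt_of_lt_of_le (Finset.card_lt_card (t := (Finset.univ.filter fun u =>
      G.dist w u + G.dist (projS u) u ≤ M).image fun u =>
        N * (G.dist w u + G.dist (projS u) u) + ident (projT u)) ?_) Finset.card_image_le
    refine (Finset.ssubset_iff_of_subset fun τ hτ => ?_).2
      ⟨_, Finset.mem_image.2 ⟨v, by simpa using hv, rfl⟩, by simp⟩
    obtain ⟨hτU, hτlt⟩ := Finset.mem_filter.1 hτ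
    obtain ⟨u, rfl⟩ := (hmemU τ).1 hτU
    refine Finset.mem_image.2 ⟨u, Finset.mem_filter.2 ⟨Finset.mem_univ u, ?_⟩, rfl⟩
    have := Nat.div_le_div_right (c := N) hτlt.le
    rw [div_of_token hid, div_of_token hid] at this
    exact this.trans hv
  simp only [h₇, hmemR] at hr₈
  have hf₈ : ∀ v, farthest N (r₈ v) = R.sup fun u => G.dist u v := fun v => by
    rw [hr₈]
    exact farthest_bfs hG hinj hid hb hD hRK hrK v
  -- the output
  simp only [hf₄, hf₈, hinS] at hr₉
  obtain ⟨y, hy⟩ : ∃ y : V → ℕ, ∀ v, y v = if v ∈ S then R.sup fun u => G.dist u v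
    else max (Y.sup fun u => G.dist u v) (G.dist w v) := ⟨_, fun _ => rfl⟩
  simp only [← hy] at hr₉
  have hyn : ∀ v, y v ≤ n := by
    intro v
    rw [hy]
    split_ifs
    · exact Finset.sup_le fun u _ => hn u v
    · exact max_le (Finset.sup_le fun u _ => hn u v) (hn w v)
  obtain ⟨v₀, -, hv₀⟩ := Finset.exists_max_image Finset.univ y ⟨w, Finset.mem_univ w⟩
  have hout : ∀ v, n - sInf (r₉ v : Set ℕ) = y v₀ := by
    intro v
    have hmem : n - y v₀ ∈ Finset.univ.biUnion fun v => ({n - y v} : Finset ℕ) :=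
      Finset.mem_biUnion.2 ⟨v₀, Finset.mem_univ v₀, by simp⟩
    have : sInf (r₉ v : Set ℕ) = n - y v₀ := by
      rw [hr₉, gossip_sInf hG ?_ hD ⟨_, hmem⟩ hrD]
      · refine le_antisymm (Nat.sInf_le hmem) (le_csInf ⟨_, hmem⟩ fun τ hτ => ?_)
        obtain ⟨u, -, hu⟩ := Finset.mem_biUnion.1 hτ
        have := hv₀ u (Finset.mem_univ u)
        rw [Finset.mem_singleton.1 hu]
        omega
      · intro v τ hτ
        rw [Finset.mem_singleton.1 hτ]
        have h1 := hid v
        have h2 : 1 * (2 * n + 1) ≤ N * (2 * n + 1) := Nat.mul_le_mul_right _ (by omega)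
        omega
    have := hyn v₀
    omega
  refine ⟨y v₀, ?_, ?_, hout⟩
  · obtain ⟨s₀, hs₀, t₀, ht₀, hst⟩ := exists_dist_eq_stDiam (G := G) hS hT
    rw [← hst]
    have hle : ∀ v, y v ≤ y v₀ := fun v => hv₀ v (Finset.mem_univ v)
    refine three_mul_dist_div_five_le hG hST ht₀ hs₀ hwS hprojS hprojT (X := X) (R := R)
      (fun M hM x hx => ?_) hRnear (fun x hx t ht => ?_) (fun t ht => ?_) (fun r hr s hs => ?_)
    · refine hnear s₀ w (hw s₀ hs₀) M (fun y hy => ?_) _ (hY ▸ Finset.mem_image_of_mem projS hx)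
      rw [hY] at hy
      obtain ⟨x', hx', rfl⟩ := Finset.mem_image.1 hy
      exact hM x' hx'
    · refine le_trans ?_ (hle t)
      rw [hy, if_neg ((hST t).2 ht)]
      exact le_max_of_le_left (Finset.le_sup (f := fun u => G.dist u t)
        (hY ▸ Finset.mem_image_of_mem projS hx))
    · refine le_trans ?_ (hle t)
      rw [hy, if_neg ((hST t).2 ht)]
      exact le_max_right _ _
    · refine le_trans ?_ (hle s)
      rw [hy, if_pos hs]
      exact Finset.le_sup (f := fun u => G.dist u s) hr
  · rw [hy]
    split_ifs with h
    · refine Finset.sup_le fun u hu => ?_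
      rw [G.dist_comm]
      exact dist_le_stDiam h (hRT hu)
    · exact max_le (Finset.sup_le fun u hu => dist_le_stDiam (hYS hu) ((hST v₀).1 h))
        (dist_le_stDiam hwS ((hST v₀).1 h))

end Correctness

/-! ### Message length and running time -/

section Bounds

theorem identBound_mul_le (c : ℕ) {n : ℕ} (hn : 2 ≤ n) :
    (n ^ c + 1) * (10 * n) ≤ 2 ^ ((c + 6) * Nat.clog 2 n) := by
  have h1 : n ≤ 2 ^ Nat.clog 2 n := Nat.le_pow_clog (by norm_num) n
  have h2 : 1 ≤ n ^ c := Nat.one_le_pow _ _ (by omega)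
  have h3 : 20 ≤ n ^ 5 := le_trans (by norm_num) (Nat.pow_le_pow_left hn 5)
  calc (n ^ c + 1) * (10 * n) ≤ (2 * n ^ c) * (10 * n) := Nat.mul_le_mul_right _ (by omega)
    _ = n ^ (c + 1) * 20 := by ring
    _ ≤ n ^ (c + 1) * n ^ 5 := Nat.mul_le_mul_left _ h3
    _ = n ^ (c + 6) := by ring
    _ ≤ (2 ^ Nat.clog 2 n) ^ (c + 6) := Nat.pow_le_pow_left h1 _
    _ = 2 ^ ((c + 6) * Nat.clog 2 n) := by rw [← pow_mul, mul_comm]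

theorem half_le_log {n : ℕ} (hn : 2 ≤ n) : 1 / 2 ≤ Real.log n := by
  have h1 : Real.log 2 ≤ Real.log n := Real.log_le_log (by norm_num) (by exact_mod_cast hn)
  have := Real.log_two_gt_d9
  linarith

theorem clog_le_three_mul_log {n : ℕ} (hn : 2 ≤ n) : (Nat.clog 2 n : ℝ) ≤ 3 * Real.log n := by
  have hl : 1 ≤ Nat.clog 2 n := Nat.clog_pos (by norm_num) hn
  have h1 : 2 ^ (Nat.clog 2 n - 1) < n := Nat.pow_pred_clog_lt_self (by norm_num) hn
  have h2 : Real.log ((2 : ℝ) ^ (Nat.clog 2 n - 1)) ≤ Real.log n :=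
    Real.log_le_log (by positivity) (by exact_mod_cast h1.le)
  rw [Real.log_pow, Nat.cast_sub hl, Nat.cast_one] at h2
  have h3 : Real.log 2 ≤ Real.log n := Real.log_le_log (by norm_num) (by exact_mod_cast hn)
  have h4 := Real.log_two_gt_d9
  have h5 : (1 : ℝ) ≤ Nat.clog 2 n := by exact_mod_cast hl
  nlinarith

theorem sampleBound_le (k : ℕ) {n : ℕ} (hn : 2 ≤ n) :
    (sampleBound k n : ℝ) ≤ 3 * (k + 7) * Real.log n * Real.sqrt n := by
  have h1 : (sampleBound k n : ℝ) ≤ (2 ^ sampleBits n : ℕ) * ((k + 7) * Nat.clog 2 n) := by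
    exact_mod_cast (min_le_right _ _ : sampleBound k n ≤ _)
  have h2 : ((2 ^ sampleBits n : ℕ) : ℝ) ≤ Real.sqrt n :=
    Real.le_sqrt_of_sq_le (by exact_mod_cast two_pow_sampleBits_sq_le (n := n) (by omega))
  have h3 := clog_le_three_mul_log hn
  calc (sampleBound k n : ℝ) ≤ (2 ^ sampleBits n : ℕ) * ((k + 7) * Nat.clog 2 n) := h1
    _ ≤ Real.sqrt n * ((k + 7) * (3 * Real.log n)) := by gcongr
    _ = _ := by ring

/-- The guesses cost a geometric sum, at most `18 * 2 ^ i`, and the main part at most `45 * 2 ^ i +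
9 * sampleBound k n`; with `2 ^ i ≤ 2 * D` this gives `126 * D`. The factor 252 comes from $\log
n\ge 1/2$. -/
theorem time_le {k n D t i : ℕ} (hn : 2 ≤ n) (hi : 2 ^ i ≤ 2 * D)
    (ht : t = guessTime (i + 1) + 9 * (4 * 2 ^ i + sampleBound k n + 1)) :
    (t : ℝ) ≤ (252 + 27 * (k + 7) : ℝ) * Real.log n ^ 1 * (Real.sqrt n + D) := by
  have h1 := guessTime_le (i + 1)
  have h2 : 1 ≤ 2 ^ i := Nat.one_le_two_pow
  have h3 : t ≤ 126 * D + 9 * sampleBound k n := by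
    rw [pow_succ] at h1
    omega
  have h4 : (t : ℝ) ≤ 126 * D + 9 * sampleBound k n := by exact_mod_cast h3
  have h5 := sampleBound_le k hn
  have h6 := half_le_log hn
  have h7 : (D : ℝ) ≤ 2 * Real.log n * D :=
    le_mul_of_one_le_left (Nat.cast_nonneg D) (by linarith)
  have h8 : 0 ≤ (k + 7 : ℝ) * Real.log n * D := by positivity
  have h9 : 0 ≤ Real.log n * Real.sqrt n := by positivity
  nlinarith

end Bounds

section Graph

variable {V : Type} [Fintype V] {G : SimpleGraph V}

theorem dist_le_diam_of_connected (hG : G.Connected) (u v : V) : G.dist u v ≤ G.diam := by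
  have := hG.nonempty
  exact SimpleGraph.dist_le_diam (SimpleGraph.connected_iff_ediam_ne_top.1 hG)

theorem diam_lt_card (hG : G.Connected) : G.diam < Fintype.card V := by
  have := hG.nonempty
  obtain ⟨u, v, huv⟩ := G.exists_dist_eq_diam
  obtain ⟨p, hp, hp'⟩ := hG.exists_path_of_dist u v
  rw [← huv, ← hp']
  exact hp.length_lt

end Graph

end BichromaticDiameter

/-! ### Assembly -/

open BichromaticDiameter in
theorem mainTheorem4 (c : ℕ) :
    ∃ B e : ℕ, ∀ k : ℕ, ∃ (C : ℝ) (A : ∀ n : ℕ, CongestAlgorithm (B * Nat.clog 2 n) Bool ℕ),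
      ∀ (n : ℕ) (V : Type) [Fintype V] [DecidableEq V] (G : SimpleGraph V) (S T : Finset V)
        (ident : V → ℕ),
        Fintype.card V = n → G.Connected → S.Nonempty → T.Nonempty → S = Finset.univ \ T →
        Function.Injective ident → (∀ v, ident v ≤ n ^ c) →
        ∃ t : ℕ, (t : ℝ) ≤ C * Real.log n ^ e * (Real.sqrt n + G.diam) ∧
          (∀ (ω : V → Fin (A n).coins → Bool) (v : V),
            ((A n).outputAt G ident (fun u => decide (u ∈ S)) ω t v).isSome) ∧
          1 - 1 / (n : ℝ) ^ k ≤ (coinMeasure V (A n).coins).real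
            {ω | ∃ Dstar : ℕ,
              ⌊(3 / 5 : ℝ) * stDiam G S T⌋₊ ≤ Dstar ∧ Dstar ≤ stDiam G S T ∧
              ∀ v, (A n).outputAt G ident (fun u => decide (u ∈ S)) ω t v = some Dstar} := by
  refine ⟨c + 6, 1, fun k => ⟨252 + 27 * (k + 7), fun n => (program c k n).toCongest _, ?_⟩⟩
  intro n V _ _ G S T ident hcard hG hS hT hSTeq hinj hle
  subst hcard
  have hST : ∀ v, v ∉ S ↔ v ∈ T := fun v => by simp [hSTeq]
  obtain ⟨s, hs⟩ := hS
  obtain ⟨t, ht⟩ := hT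
  have hst : s ≠ t := fun h => (hST t).2 ht (h ▸ hs)
  have hn : 2 ≤ Fintype.card V := Fintype.one_lt_card_iff.2 ⟨s, t, hst⟩
  have hdiam := dist_le_diam_of_connected hG
  have hdiam1 : 1 ≤ G.diam := (hG.pos_dist_of_ne hst).trans_le (hdiam s t)
  have hdiamn := diam_lt_card hG
  have hid : ∀ v, ident v < Fintype.card V ^ c + 1 := fun v => Nat.lt_succ_of_le (hle v)
  have hbig := identBound_mul_le c hn
  -- The cap at `n` in `sampleBound` makes the message length independent of `k`.
  have hKn : sampleBound k (Fintype.card V) ≤ Fintype.card V := min_le_left _ _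
  obtain ⟨N, hN⟩ : ∃ N, N = Fintype.card V ^ c + 1 := ⟨_, rfl⟩
  obtain ⟨b, hb⟩ : ∃ b, b = (c + 6) * Nat.clog 2 (Fintype.card V) := ⟨_, rfl⟩
  rw [← hN] at hid hbig
  rw [← hb] at hbig
  have hbN : ∀ v, ident v < 2 ^ b := fun v =>
    (hid v).trans_le ((Nat.le_mul_of_pos_right _ (by omega)).trans hbig)
  obtain ⟨i, hfail, hpass, hD, hi⟩ := exists_first_guess hG hbN hinj hdiam1 hdiam
  obtain ⟨K, hK⟩ : ∃ K, K = sampleBound k (Fintype.card V) := ⟨_, rfl⟩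
  have hb₁ : N * (4 * 2 ^ i + K + 2) ≤ 2 ^ b :=
    (Nat.mul_le_mul_left _ (by omega)).trans hbig
  have hb₂ : N * (2 * Fintype.card V + 1) ≤ 2 ^ b :=
    (Nat.mul_le_mul_left _ (by omega)).trans hbig
  have hsrcS : (fun v => if decide (v ∈ S) then ({ident v} : Finset ℕ) else ∅) =
      sourceTokens ident S := by
    funext v
    simp [sourceTokens]
  have hsrcT : (fun v => if decide (v ∈ S) then (∅ : Finset ℕ) else {ident v}) =
      sourceTokens ident T := by
    funext v
    simp only [sourceTokens, ← hST, decide_eq_true_eq, ite_not]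
  choose projS hprojSS hprojS hr₁ using
    bfs_nearest (r := 4 * 2 ^ i + K + 1) hG hinj hid hb₁ hD (by omega) ⟨s, hs⟩
  choose projT hprojTT hprojT hr₂ using
    bfs_nearest (r := 4 * 2 ^ i + K + 1) hG hinj hid hb₁ hD (by omega) ⟨t, ht⟩
  rw [← hsrcS] at hr₁
  rw [← hsrcT] at hr₂
  have hrun : ∀ ω : V → Fin (sampleBits (Fintype.card V)) → Bool, ∃ r₉ : V → Finset ℕ,
      (∀ v, ((program c k (Fintype.card V)).toCongest b).outputAt G ident (fun u => decide (u ∈ S))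
        ω (guessTime (i + 1) + 9 * (4 * 2 ^ i + K + 1)) v =
          some (Fintype.card V - sInf (r₉ v : Set ℕ))) ∧
      (GoodSample K (fun w v => G.dist w v + G.dist (projS v) v) (sampled ω) →
        ∃ d, 3 * stDiam G S T / 5 ≤ d ∧ d ≤ stDiam G S T ∧
          ∀ v, Fintype.card V - sInf (r₉ v : Set ℕ) = d) := by
    intro ω
    obtain ⟨r₁, r₂, r₃, r₄, r₅, r₆, r₇, r₈, r₉, h₁, h₂, h₃, h₄, h₅, h₆, h₇, h₈, h₉, h⟩ :=
      exists_main_results hinj hN hK rfl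
        (reachesAt_main (c := c) (k := k) (x := fun u => decide (u ∈ S)) hG hbN hinj ω i hfail hpass)
    refine ⟨r₉, fun v => h.outputAt_eq rfl, fun hgood => ?_⟩
    exact main_correct hG hinj hid hST ⟨s, hs⟩ ⟨t, ht⟩
      (fun u v => (hdiam u v).trans hdiamn.le) hD hb₁ hb₂ hprojS hprojSS hprojTT hprojT hgood
      (inS := fun v => decide (v ∈ S)) (smp := fun v => decide (ω v = fun _ => true))
      (fun v => by simp) (fun v => by simp [sampled])
      (fun v => (congrArg (fun F : Finset ℕ => sInf (F : Set ℕ)) (h₁ v)).trans (hr₁ v))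
      (fun v => (congrArg (fun F : Finset ℕ => sInf (F : Set ℕ)) (h₂ v)).trans (hr₂ v))
      h₃ h₄ h₅ h₆ h₇ h₈ h₉
  subst hb
  -- The guessing stage uses no random bits and the main part has fixed length, so one halting time
  -- serves all `ω`, good or bad.
  refine ⟨guessTime (i + 1) + 9 * (4 * 2 ^ i + K + 1), time_le hn hi (by rw [hK]), ?_, ?_⟩
  · intro ω v
    obtain ⟨r₉, h, -⟩ := hrun ω
    exact Option.isSome_iff_exists.2 ⟨_, h v⟩
  · refine (le_coinMeasure_goodSample k hn
      (fun w v => G.dist w v + G.dist (projS v) v)).trans ?_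
    have : IsFiniteMeasure (coinMeasure V (sampleBits (Fintype.card V))) := by
      unfold coinMeasure
      infer_instance
    refine measureReal_mono (fun ω hω => ?_) (measure_ne_top _ _)
    obtain ⟨r₉, h, h'⟩ := hrun ω
    obtain ⟨d, hd₁, hd₂, hd₃⟩ := h' (hK ▸ hω)
    refine ⟨d, ?_, hd₂, fun v => ?_⟩
    · rw [show (3 / 5 : ℝ) * stDiam G S T = ((3 * stDiam G S T : ℕ) : ℝ) / (5 : ℕ) by
        push_cast; ring, Nat.floor_div_eq_div]
      exact hd₁
    · rw [← hd₃ v]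
      exact h v
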